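/- Over $\mathsf{RCA}_0$, the following are equivalent (that is, in every model of $\mathsf{RCA}_0$, standard or not, any one of them holds if and only if the others do; by the completeness theorem this means that the equivalences are provable in $\mathsf{RCA}_0$): (1) $\mathsf{ACA}_0$; (2) for every $r\in\mathbb{N}$ and every infinite set $S\subseteq r^{<\mathbb{N}}$ there is a function $g\colon\mathbb{N}\to r$ such that for all $n\in\mathbb{N}$ there is $\sigma\in S$ with $g\restriction n\subseteq\sigma$; (3) for every infinite set $S\subseteq 2^{<\mathbb{N}}$ there is a function $g\colon\mathbb{N}\to 2$ such that for all $n\in\mathbb{N}$ there is $\sigma\in S$ with $g\restriction n\subseteq\sigma$. Here $r$ is identified with $\{0,\dots,r-1\}$, and $r^{<\mathbb{N}}$ is the set of (codes of) finite sequences of numbers less than $r$. Also, $g\restriction n$ is the sequence $\langle g(0),\dots,g(n-1)\rangle$, and $\tau\subseteq\sigma$ means that $\tau$ is an initial segment of $\sigma$. Statements (2) and (3) are understood as sentences of second-order arithmetic by means of the usual coding of finite sequences in $\mathsf{RCA}_0$. $\mathsf{RCA}_0$ consists of the basic axioms for $0,1,+,\cdot,<$ together with $\Sigma^0_1$-induction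 and $\Delta^0_1$-comprehension, and $\mathsf{ACA}_0$ consists of the basic axioms, the induction axiom for sets and comprehension for arithmetical formulas (all schemes with parameters). -/

import Mathlib

universe u

/-- A structure for the two-sorted language of second-order arithmetic: numbers range over
`carrier`, sets range over the nonempty family `sets` of subsets of `carrier`, and `∈` is true
membership. -/
structure L2Structure where
  carrier : Type u
  zero : carrier
  one : carrier
  add : carrier → carrier → carrier
  mul : carrier → carrier → carrier
  lt : carrier → carrier → Prop
  sets : Set (Set carrier)
  sets_nonempty : sets.Nonempty

namespace SecondOrderArith

/-- Numerical terms; number variables are de Bruijn indices. -/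
inductive NumTerm where
  | var (i : ℕ) : NumTerm
  | zero : NumTerm
  | one : NumTerm
  | add (s t : NumTerm) : NumTerm
  | mul (s t : NumTerm) : NumTerm

/-- Arithmetical formulas: number quantifiers only, with free number variables (de Bruijn indices)
and free set variables. `all φ` is `∀ x φ`, and `ball t φ` is the bounded quantification
`∀ x (x < t → φ)` with `x` not occurring in `t`; in `φ` the variable `x` has index `0`. -/
inductive ArithFormula where
  | eq (s t : NumTerm) : ArithFormula
  | lt (s t : NumTerm) : ArithFormula
  | mem (t : NumTerm) (X : ℕ) : ArithFormula
  | neg (φ : ArithFormula) : ArithFormula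
  | and (φ ψ : ArithFormula) : ArithFormula
  | all (φ : ArithFormula) : ArithFormula
  | ball (t : NumTerm) (φ : ArithFormula) : ArithFormula

namespace ArithFormula

/-- `∃ x φ`. -/
def ex (φ : ArithFormula) : ArithFormula := neg (all (neg φ))

/-- All quantifiers of the formula are bounded (`Σ⁰₀`). -/
def IsBounded : ArithFormula → Prop
  | eq _ _ => True
  | lt _ _ => True
  | mem _ _ => True
  | neg φ => φ.IsBounded
  | and φ ψ => φ.IsBounded ∧ ψ.IsBounded
  | all _ => False
  | ball _ φ => φ.IsBounded

/-- `φ` has the form `∃ x θ` with `θ` bounded. -/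
def IsSigma01 (φ : ArithFormula) : Prop := ∃ θ : ArithFormula, θ.IsBounded ∧ φ = ex θ

/-- `φ` has the form `∀ x θ` with `θ` bounded. -/
def IsPi01 (φ : ArithFormula) : Prop := ∃ θ : ArithFormula, θ.IsBounded ∧ φ = all θ

end ArithFormula

/-- The valuation giving index `0` the value `a` and shifting `v` up by one. -/
def push {A : Type u} (a : A) (v : ℕ → A) : ℕ → A
  | 0 => a
  | i + 1 => v i

end SecondOrderArith

namespace L2Structure

open SecondOrderArith

variable (M : L2Structure.{u})

def value (v : ℕ → M.carrier) : NumTerm → M.carrier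
  | .var i => v i
  | .zero => M.zero
  | .one => M.one
  | .add s t => M.add (value v s) (value v t)
  | .mul s t => M.mul (value v s) (value v t)

/-- Satisfaction of an arithmetical formula under the valuations `v` of the number variables and
`V` of the set variables. -/
def Sat (V : ℕ → M.sets) : ArithFormula → (ℕ → M.carrier) → Prop
  | .eq s t, v => M.value v s = M.value v t
  | .lt s t, v => M.lt (M.value v s) (M.value v t)
  | .mem t X, v => M.value v t ∈ (V X : Set M.carrier)
  | .neg φ, v => ¬ Sat V φ v
  | .and φ ψ, v => Sat V φ v ∧ Sat V ψ v
  | .all φ, v => ∀ a, Sat V φ (push a v)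
  | .ball t φ, v => ∀ a, M.lt a (M.value v t) → Sat V φ (push a v)

/-- The basic axioms of second-order arithmetic. -/
structure BasicAxioms : Prop where
  succ_ne_zero : ∀ n, M.add n M.one ≠ M.zero
  succ_inj : ∀ m n, M.add m M.one = M.add n M.one → m = n
  add_zero : ∀ m, M.add m M.zero = m
  add_succ : ∀ m n, M.add m (M.add n M.one) = M.add (M.add m n) M.one
  mul_zero : ∀ m, M.mul m M.zero = M.zero
  mul_succ : ∀ m n, M.mul m (M.add n M.one) = M.add (M.mul m n) m
  not_lt_zero : ∀ m, ¬ M.lt m M.zero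
  lt_succ : ∀ m n, M.lt m (M.add n M.one) ↔ (M.lt m n ∨ m = n)

/-- The induction axiom (for sets). -/
def SetInduction : Prop :=
  ∀ X ∈ M.sets, M.zero ∈ X → (∀ n, n ∈ X → M.add n M.one ∈ X) → ∀ n, n ∈ X

/-- The `Σ⁰₁` induction scheme, with parameters. -/
def Sigma01Induction : Prop :=
  ∀ φ : ArithFormula, φ.IsSigma01 → ∀ (V : ℕ → M.sets) (v : ℕ → M.carrier),
    M.Sat V φ (push M.zero v) →
    (∀ n, M.Sat V φ (push n v) → M.Sat V φ (push (M.add n M.one) v)) →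
    ∀ n, M.Sat V φ (push n v)

/-- The `Δ⁰₁` comprehension scheme, with parameters. -/
def Delta01Comprehension : Prop :=
  ∀ φ ψ : ArithFormula, φ.IsSigma01 → ψ.IsPi01 → ∀ (V : ℕ → M.sets) (v : ℕ → M.carrier),
    (∀ n, M.Sat V φ (push n v) ↔ M.Sat V ψ (push n v)) →
    ∃ X ∈ M.sets, ∀ n, n ∈ X ↔ M.Sat V φ (push n v)

/-- The arithmetical comprehension scheme, with parameters. -/
def ArithComprehension : Prop :=
  ∀ (φ : ArithFormula) (V : ℕ → M.sets) (v : ℕ → M.carrier),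
    ∃ X ∈ M.sets, ∀ n, n ∈ X ↔ M.Sat V φ (push n v)

/-- `M` is a model of `RCA₀`. -/
structure ModelsRCA0 : Prop where
  basic : M.BasicAxioms
  induction : M.Sigma01Induction
  comprehension : M.Delta01Comprehension

/-- `M` is a model of `ACA₀`. -/
structure ModelsACA0 : Prop where
  basic : M.BasicAxioms
  induction : M.SetInduction
  comprehension : M.ArithComprehension

/-! The usual coding of finite sequences in `RCA₀`, evaluated in `M`. -/

/-- The pairing function `(i, j) = (i + j)² + i`. -/
def pair (i j : M.carrier) : M.carrier :=
  M.add (M.mul (M.add i j) (M.add i j)) i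

/-- `c` has the form `(k, (m, n))`. -/
def IsTriple (c : M.carrier) : Prop :=
  ∃ k m n, c = M.pair k (M.pair m n)

/-- `i` belongs to the finite set determined by `c = (k, (m, n))`: `i < k` and
`m (i + 1) + 1` divides `n`. -/
def CodeMem (i c : M.carrier) : Prop :=
  ∃ k m n, c = M.pair k (M.pair m n) ∧ M.lt i k ∧
    ∃ q, n = M.mul (M.add (M.mul m (M.add i M.one)) M.one) q

/-- `c` is the code of a finite set: the least triple determining that set. -/
def IsFiniteSetCode (c : M.carrier) : Prop :=
  M.IsTriple c ∧
    ∀ c', M.IsTriple c' → (∀ i, M.CodeMem i c' ↔ M.CodeMem i c) → ¬ M.lt c' c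

/-- `s` is the code of a finite sequence, that is, of a finite set of pairs which is a function
with domain `{i : i < l}` for some `l`. -/
def IsSeqCode (s : M.carrier) : Prop :=
  M.IsFiniteSetCode s ∧
  (∀ x, M.CodeMem x s → ∃ i j, x = M.pair i j) ∧
  (∀ i j j', M.CodeMem (M.pair i j) s → M.CodeMem (M.pair i j') s → j = j') ∧
  ∃ l, ∀ i, M.lt i l ↔ ∃ j, M.CodeMem (M.pair i j) s

/-- `s ∈ r^{<ℕ}`. -/
def IsSeqBelow (r s : M.carrier) : Prop :=
  M.IsSeqCode s ∧ ∀ i j, M.CodeMem (M.pair i j) s → M.lt j r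

/-- `X` is infinite, that is, unbounded. -/
def IsInfinite (X : Set M.carrier) : Prop :=
  ¬ ∃ k, ∀ i ∈ X, M.lt i k

/-- `g` is (the graph of) a function from `ℕ` to `r = {j : j < r}`. -/
def IsFunctionTo (r : M.carrier) (g : Set M.carrier) : Prop :=
  (∀ x ∈ g, ∃ i j, x = M.pair i j ∧ M.lt j r) ∧ ∀ i, ∃! j, M.pair i j ∈ g

/-- `g ↾ n ⊆ s`, where `g` is the graph of a function and `s` codes a finite sequence. -/
def RestrictSubset (g : Set M.carrier) (n s : M.carrier) : Prop :=
  ∀ i j, M.lt i n → M.pair i j ∈ g → M.CodeMem (M.pair i j) s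

/-- For the number `r`: if `S ⊆ r^{<ℕ}` is infinite, then there is `g : ℕ → r` such that for all
`n` there is `σ ∈ S` with `g ↾ n ⊆ σ`. -/
def InitialSegmentPrinciple (r : M.carrier) : Prop :=
  ∀ S ∈ M.sets, (∀ s ∈ S, M.IsSeqBelow r s) → M.IsInfinite S →
    ∃ g ∈ M.sets, M.IsFunctionTo r g ∧ ∀ n, ∃ s ∈ S, M.RestrictSubset g n s

end L2Structure

namespace L2Structure

open SecondOrderArith

variable {M : L2Structure.{u}}

/-! From (3) to (1): for a bounded `P`, let the stage of length `l` be the 0-1 sequence whose `n`th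
term is 1 iff some `a < l` satisfies `P a n`. The codes of stages form an unbounded set that exists
by Δ⁰₁ comprehension, since a stage's length is at most its code. If every restriction of `g` lies
in a stage, then long restrictions lie in late stages, so `g n = 1` exactly when `∃ a, P a n`. Hence
Σ⁰₁ sets exist (`sigma_comprehension_of_principle`). Any arithmetical relation then becomes bounded,
with new set parameters: an unbounded quantifier is replaced by membership of a coded tuple in a Σ⁰₁
set (`Definable.toBounded`).

From (1) to (2): follow the leftmost path, taking at each level the least value with which
unboundedly many members of `S` extend the path so far. A value exists because otherwise all
sufficiently large members of `S` extending the current `τ` would have the same elements as `τ`;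
codes being canonical, there is at most one such member (`IsLeftmost.exists_extendible`).
Arithmetical comprehension yields the union of these approximations.

As `M` may be nonstandard, everything rests on the induction available in `M`. Complexity is tracked
semantically by `Definable`, with elements and sets of `M` as parameters, and turned into formulas
only by `Definable.exists_formula`. The sequence codes require arithmetic and Gödel's β-function
argument inside `M` (`exists_isFiniteSetCode`). -/

instance : Zero M.carrier := ⟨M.zero⟩
instance : One M.carrier := ⟨M.one⟩
instance : Add M.carrier := ⟨M.add⟩
instance : Mul M.carrier := ⟨M.mul⟩
instance : LT M.carrier := ⟨M.lt⟩

/-! ### Definable relations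

Relations on valuations, with arbitrary elements and sets of the structure as parameters. -/

/-- Functions of the number variables given by a term with parameters. -/
inductive IsTerm : ((ℕ → M.carrier) → M.carrier) → Prop
  | var (i : ℕ) : IsTerm fun x => x i
  | const (c : M.carrier) : IsTerm fun _ => c
  | add {s t : (ℕ → M.carrier) → M.carrier} :
      IsTerm s → IsTerm t → IsTerm fun x => s x + t x
  | mul {s t : (ℕ → M.carrier) → M.carrier} :
      IsTerm s → IsTerm t → IsTerm fun x => s x * t x

/-- Relations given by an arithmetical formula with parameters; all quantifiers are bounded
unless the Boolean index is `true`. -/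
inductive Definable : Bool → ((ℕ → M.carrier) → Prop) → Prop
  | eq {b : Bool} {s t : (ℕ → M.carrier) → M.carrier} :
      IsTerm s → IsTerm t → Definable b fun x => s x = t x
  | lt {b : Bool} {s t : (ℕ → M.carrier) → M.carrier} :
      IsTerm s → IsTerm t → Definable b fun x => s x < t x
  | mem {b : Bool} {X : Set M.carrier} {t : (ℕ → M.carrier) → M.carrier} :
      X ∈ M.sets → IsTerm t → Definable b fun x => t x ∈ X
  | not {b : Bool} {P : (ℕ → M.carrier) → Prop} :
      Definable b P → Definable b fun x => ¬ P x
  | and {b : Bool} {P Q : (ℕ → M.carrier) → Prop} :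
      Definable b P → Definable b Q → Definable b fun x => P x ∧ Q x
  | all_push {P : (ℕ → M.carrier) → Prop} :
      Definable true P → Definable true fun x => ∀ a, P (push a x)
  | ball_push {b : Bool} {t : (ℕ → M.carrier) → M.carrier} {P : (ℕ → M.carrier) → Prop} :
      IsTerm t → Definable b P → Definable b fun x => ∀ a, a < t x → P (push a x)

namespace IsTerm

theorem subst {t : (ℕ → M.carrier) → M.carrier} (ht : IsTerm t)
    {σ : ℕ → (ℕ → M.carrier) → M.carrier} (hσ : ∀ i, IsTerm (σ i)) :
    IsTerm fun x => t fun i => σ i x := by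
  induction ht with
  | var i => exact hσ i
  | const c => exact const c
  | add _ _ h₁ h₂ => exact add h₁ h₂
  | mul _ _ h₁ h₂ => exact mul h₁ h₂

theorem pair {s t : (ℕ → M.carrier) → M.carrier} (hs : IsTerm s) (ht : IsTerm t) :
    IsTerm fun x => M.pair (s x) (t x) :=
  ((hs.add ht).mul (hs.add ht)).add hs

end IsTerm

namespace Definable

variable {b : Bool} {P Q : (ℕ → M.carrier) → Prop} {s t : (ℕ → M.carrier) → M.carrier}

theorem of_iff (h : Definable b P) (hPQ : ∀ x, Q x ↔ P x) : Definable b Q := by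
  have : Q = P := funext fun x => propext (hPQ x)
  exact this ▸ h

theorem subst (h : Definable b P) {σ : ℕ → (ℕ → M.carrier) → M.carrier}
    (hσ : ∀ i, IsTerm (σ i)) : Definable b fun x => P fun i => σ i x := by
  -- Under a quantifier the bound variable 0 is kept and the substituted terms are shifted past it.
  have lift : ∀ {σ : ℕ → (ℕ → M.carrier) → M.carrier}, (∀ i, IsTerm (σ i)) →
      ∀ i, IsTerm (fun x : ℕ → M.carrier => push (x 0) (fun i => σ i fun j => x (j + 1)) i) := by
    intro σ hσ i
    cases i with
    | zero => exact .var 0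
    | succ i => exact (hσ i).subst fun j => .var (j + 1)
  induction h generalizing σ with
  | eq hs ht => exact eq (hs.subst hσ) (ht.subst hσ)
  | lt hs ht => exact lt (hs.subst hσ) (ht.subst hσ)
  | mem hX ht => exact mem hX (ht.subst hσ)
  | not _ ih => exact (ih hσ).not
  | and _ _ ih₁ ih₂ => exact (ih₁ hσ).and (ih₂ hσ)
  | all_push _ ih => exact (ih (lift hσ)).all_push
  | ball_push ht _ ih => exact (ih (lift hσ)).ball_push (ht.subst hσ)

theorem or (hP : Definable b P) (hQ : Definable b Q) : Definable b fun x => P x ∨ Q x :=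
  (hP.not.and hQ.not).not.of_iff fun x => by tauto

theorem imp (hP : Definable b P) (hQ : Definable b Q) : Definable b fun x => P x → Q x :=
  (hP.and hQ.not).not.of_iff fun x => by tauto

theorem iff (hP : Definable b P) (hQ : Definable b Q) : Definable b fun x => P x ↔ Q x :=
  ((hP.imp hQ).and (hQ.imp hP)).of_iff fun x => by tauto

theorem all {R : M.carrier → (ℕ → M.carrier) → Prop}
    (h : Definable true fun x => R (x 0) fun i => x (i + 1)) :
    Definable true fun x => ∀ a, R a x :=
  h.all_push

theorem ex {R : M.carrier → (ℕ → M.carrier) → Prop}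
    (h : Definable true fun x => R (x 0) fun i => x (i + 1)) :
    Definable true fun x => ∃ a, R a x :=
  h.not.all_push.not.of_iff fun x => by rw [not_forall_not]; rfl

theorem ball {R : M.carrier → (ℕ → M.carrier) → Prop} (ht : IsTerm t)
    (h : Definable b fun x => R (x 0) fun i => x (i + 1)) :
    Definable b fun x => ∀ a, a < t x → R a x :=
  h.ball_push ht

theorem bex {R : M.carrier → (ℕ → M.carrier) → Prop} (ht : IsTerm t)
    (h : Definable b fun x => R (x 0) fun i => x (i + 1)) :
    Definable b fun x => ∃ a, a < t x ∧ R a x :=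
  (h.not.ball_push ht).not.of_iff fun x => by
    change _ ↔ ¬ ∀ a, a < t x → ¬ R a x
    push Not
    rfl

end Definable

/-! ### Definable relations and formulas -/

theorem isTerm_value (t : NumTerm) : IsTerm fun x : ℕ → M.carrier => M.value x t := by
  induction t with
  | var i => exact .var i
  | zero => exact .const M.zero
  | one => exact .const M.one
  | add s t hs ht => exact hs.add ht
  | mul s t hs ht => exact hs.mul ht

theorem definable_sat (V : ℕ → M.sets) (φ : ArithFormula) : Definable true (M.Sat V φ) := by
  induction φ with
  | eq s t => exact .eq (isTerm_value s) (isTerm_value t)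
  | lt s t => exact .lt (isTerm_value s) (isTerm_value t)
  | mem t X => exact .mem (V X).2 (isTerm_value t)
  | neg φ ih => exact ih.not
  | and φ ψ ih₁ ih₂ => exact ih₁.and ih₂
  | all φ ih => exact ih.all_push
  | ball t φ ih => exact ih.ball_push (isTerm_value t)

/-- The valuation with the first `K` values from `x` and then the values of `w`. -/
def mix {A : Type u} (K : ℕ) (x w : ℕ → A) (i : ℕ) : A := if i < K then x i else w (i - K)

theorem push_mix {A : Type u} (K : ℕ) (x w : ℕ → A) (a : A) :
    push a (mix K x w) = mix (K + 1) (push a x) w := by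
  funext i
  cases i <;> simp [push, mix]

/-- Parameters become variables placed after the first `K`. The valuation `w` and the cutoff `K` are
universally quantified, so that subterms with different parameters can later share one choice of
both. -/
theorem IsTerm.exists_numTerm {t : (ℕ → M.carrier) → M.carrier} (ht : IsTerm t) :
    ∃ (C : List M.carrier) (K₀ : ℕ), ∀ (w : ℕ → M.carrier) (K : ℕ),
      (∀ c ∈ C, ∃ i, w i = c) → K₀ ≤ K →
        ∃ t' : NumTerm, ∀ x, M.value (mix K x w) t' = t x := by
  induction ht with
  | var i =>
    exact ⟨[], i + 1, fun w K _ hK => ⟨.var i, fun x => if_pos (by omega)⟩⟩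
  | const c =>
    refine ⟨[c], 0, fun w K hw _ => ?_⟩
    obtain ⟨i, hi⟩ := hw c (by simp)
    exact ⟨.var (K + i), fun x => by simp [value, mix, hi]⟩
  | add _ _ ih₁ ih₂ =>
    obtain ⟨C₁, K₁, h₁⟩ := ih₁
    obtain ⟨C₂, K₂, h₂⟩ := ih₂
    refine ⟨C₁ ++ C₂, max K₁ K₂, fun w K hw hK => ?_⟩
    obtain ⟨t₁, ht₁⟩ := h₁ w K (fun c hc => hw c (by simp [hc])) (by omega)
    obtain ⟨t₂, ht₂⟩ := h₂ w K (fun c hc => hw c (by simp [hc])) (by omega)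
    exact ⟨.add t₁ t₂, fun x => by beta_reduce; rw [← ht₁, ← ht₂]; rfl⟩
  | mul _ _ ih₁ ih₂ =>
    obtain ⟨C₁, K₁, h₁⟩ := ih₁
    obtain ⟨C₂, K₂, h₂⟩ := ih₂
    refine ⟨C₁ ++ C₂, max K₁ K₂, fun w K hw hK => ?_⟩
    obtain ⟨t₁, ht₁⟩ := h₁ w K (fun c hc => hw c (by simp [hc])) (by omega)
    obtain ⟨t₂, ht₂⟩ := h₂ w K (fun c hc => hw c (by simp [hc])) (by omega)
    exact ⟨.mul t₁ t₂, fun x => by beta_reduce; rw [← ht₁, ← ht₂]; rfl⟩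

theorem Definable.exists_formula_aux {b : Bool} {P : (ℕ → M.carrier) → Prop}
    (h : Definable b P) :
    ∃ (L : List (Set M.carrier)) (C : List M.carrier) (K₀ : ℕ), (∀ X ∈ L, X ∈ M.sets) ∧
      ∀ (V : ℕ → M.sets) (w : ℕ → M.carrier) (K : ℕ),
        (∀ X ∈ L, ∃ i, (V i : Set M.carrier) = X) → (∀ c ∈ C, ∃ i, w i = c) → K₀ ≤ K →
        ∃ φ : ArithFormula, (b = false → φ.IsBounded) ∧ ∀ x, M.Sat V φ (mix K x w) ↔ P x := by
  induction h with
  | eq hs ht =>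
    obtain ⟨C₁, K₁, h₁⟩ := hs.exists_numTerm
    obtain ⟨C₂, K₂, h₂⟩ := ht.exists_numTerm
    refine ⟨[], C₁ ++ C₂, max K₁ K₂, by simp, fun V w K _ hw hK => ?_⟩
    obtain ⟨t₁, ht₁⟩ := h₁ w K (fun c hc => hw c (by simp [hc])) (by omega)
    obtain ⟨t₂, ht₂⟩ := h₂ w K (fun c hc => hw c (by simp [hc])) (by omega)
    exact ⟨.eq t₁ t₂, fun _ => trivial, fun x => by beta_reduce; rw [← ht₁, ← ht₂]; rfl⟩
  | lt hs ht =>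
    obtain ⟨C₁, K₁, h₁⟩ := hs.exists_numTerm
    obtain ⟨C₂, K₂, h₂⟩ := ht.exists_numTerm
    refine ⟨[], C₁ ++ C₂, max K₁ K₂, by simp, fun V w K _ hw hK => ?_⟩
    obtain ⟨t₁, ht₁⟩ := h₁ w K (fun c hc => hw c (by simp [hc])) (by omega)
    obtain ⟨t₂, ht₂⟩ := h₂ w K (fun c hc => hw c (by simp [hc])) (by omega)
    exact ⟨.lt t₁ t₂, fun _ => trivial, fun x => by beta_reduce; rw [← ht₁, ← ht₂]; rfl⟩
  | @mem b X t hX ht =>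
    obtain ⟨C, K₀, h⟩ := ht.exists_numTerm
    refine ⟨[X], C, K₀, by simpa using hX, fun V w K hV hw hK => ?_⟩
    obtain ⟨i, hi⟩ := hV X (by simp)
    obtain ⟨t', ht'⟩ := h w K hw hK
    exact ⟨.mem t' i, fun _ => trivial, fun x => by beta_reduce; rw [← ht', ← hi]; rfl⟩
  | not _ ih =>
    obtain ⟨L, C, K₀, hL, h⟩ := ih
    refine ⟨L, C, K₀, hL, fun V w K hV hw hK => ?_⟩
    obtain ⟨φ, hφ, h⟩ := h V w K hV hw hK
    exact ⟨.neg φ, hφ, fun x => not_congr (h x)⟩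
  | and _ _ ih₁ ih₂ =>
    obtain ⟨L₁, C₁, K₁, hL₁, h₁⟩ := ih₁
    obtain ⟨L₂, C₂, K₂, hL₂, h₂⟩ := ih₂
    refine ⟨L₁ ++ L₂, C₁ ++ C₂, max K₁ K₂, ?_, fun V w K hV hw hK => ?_⟩
    · intro X hX
      rcases List.mem_append.1 hX with hX | hX
      exacts [hL₁ X hX, hL₂ X hX]
    obtain ⟨φ, hφ, h₁⟩ := h₁ V w K (fun X hX => hV X (by simp [hX]))
      (fun c hc => hw c (by simp [hc])) (by omega)
    obtain ⟨ψ, hψ, h₂⟩ := h₂ V w K (fun X hX => hV X (by simp [hX]))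
      (fun c hc => hw c (by simp [hc])) (by omega)
    exact ⟨.and φ ψ, fun hb => ⟨hφ hb, hψ hb⟩, fun x => and_congr (h₁ x) (h₂ x)⟩
  | all_push _ ih =>
    obtain ⟨L, C, K₀, hL, h⟩ := ih
    refine ⟨L, C, K₀, hL, fun V w K hV hw hK => ?_⟩
    obtain ⟨φ, hφ, h⟩ := h V w (K + 1) hV hw (by omega)
    exact ⟨.all φ, nofun, fun x => forall_congr' fun a => by rw [← h, push_mix]⟩
  | ball_push ht _ ih =>
    obtain ⟨C₁, K₁, h₁⟩ := ht.exists_numTerm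
    obtain ⟨L, C, K₀, hL, h⟩ := ih
    refine ⟨L, C₁ ++ C, max K₁ K₀, hL, fun V w K hV hw hK => ?_⟩
    obtain ⟨t', ht'⟩ := h₁ w K (fun c hc => hw c (by simp [hc])) (by omega)
    obtain ⟨φ, hφ, h⟩ := h V w (K + 1) hV (fun c hc => hw c (by simp [hc])) (by omega)
    refine ⟨.ball t' φ, hφ, fun x => forall_congr' fun a => ?_⟩
    rw [← h, ← push_mix, ht' x]
    rfl

/-- A definable relation is given by a formula whose first `K` variables are the variables of the
relation and whose other variables are parameters. -/
theorem Definable.exists_formula {b : Bool} {P : (ℕ → M.carrier) → Prop} (h : Definable b P)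
    (k : ℕ) :
    ∃ (V : ℕ → M.sets) (w : ℕ → M.carrier) (K : ℕ) (φ : ArithFormula),
      (b = false → φ.IsBounded) ∧ ∀ x, M.Sat V φ (mix (K + k) x w) ↔ P x := by
  obtain ⟨L, C, K, hL, h⟩ := h.exists_formula_aux
  obtain ⟨X₀, hX₀⟩ := M.sets_nonempty
  -- Only the finitely many parameters matter; `X₀` and 0 are padding.
  let V : ℕ → M.sets := fun i => if hi : i < L.length then ⟨L[i], hL _ (by simp)⟩ else ⟨X₀, hX₀⟩
  have hV : ∀ X ∈ L, ∃ i, (V i : Set M.carrier) = X := fun X hX => by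
    obtain ⟨i, hi, rfl⟩ := List.mem_iff_getElem.1 hX
    exact ⟨i, by simp [V, hi]⟩
  have hw : ∀ c ∈ C, ∃ i, C.getD i 0 = c := fun c hc => by
    obtain ⟨i, hi, rfl⟩ := List.mem_iff_getElem.1 hc
    exact ⟨i, by simp [hi]⟩
  obtain ⟨φ, hφ⟩ := h V (fun i => C.getD i 0) (K + k) hV hw (by omega)
  exact ⟨V, _, K, φ, hφ⟩

theorem Definable.exists_support {b : Bool} {P : (ℕ → M.carrier) → Prop} (h : Definable b P) :
    ∃ K : ℕ, ∀ x y : ℕ → M.carrier, (∀ i < K, x i = y i) → (P x ↔ P y) := by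
  obtain ⟨V, w, K, φ, -, h⟩ := h.exists_formula 0
  refine ⟨K, fun x y hxy => ?_⟩
  rw [← h, ← h]
  have : mix (K + 0) x w = mix (K + 0) y w := by
    funext i
    by_cases hi : i < K <;> simp [mix, hi, hxy]
  rw [this]

/-! ### Induction and comprehension for definable relations -/

theorem ModelsRCA0.sigma_induction (hM : M.ModelsRCA0) {P : M.carrier → M.carrier → Prop}
    (h : Definable false fun x => P (x 0) (x 1)) (zero : ∃ a, P a 0)
    (succ : ∀ n, (∃ a, P a n) → ∃ a, P a (n + 1)) (n : M.carrier) : ∃ a, P a n := by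
  -- The 2 leaves room for the witness and the induction variable, pushed in front of `mix K`.
  obtain ⟨V, w, K, φ, hb, hφ⟩ := h.exists_formula 2
  have key : ∀ n, M.Sat V φ.ex (push n (mix K (fun _ => 0) w)) ↔ ∃ a, P a n := by
    intro n
    change (¬ ∀ a, ¬ M.Sat V φ (push a (push n _))) ↔ _
    rw [not_forall_not]
    refine exists_congr fun a => ?_
    rw [push_mix, push_mix, hφ]
    rfl
  rw [← key]
  exact hM.induction φ.ex ⟨φ, hb rfl, rfl⟩ V _ ((key 0).2 zero)
    (fun n hn => (key (n + 1)).2 (succ n ((key n).1 hn))) n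

theorem ModelsRCA0.bounded_induction (hM : M.ModelsRCA0) {P : M.carrier → Prop}
    (h : Definable false fun x => P (x 0)) (zero : P 0) (succ : ∀ n, P n → P (n + 1))
    (n : M.carrier) : P n := by
  obtain ⟨_, h⟩ := hM.sigma_induction (P := fun _ n => P n)
    (h.subst (σ := fun _ x => x 1) fun _ => .var 1) ⟨0, zero⟩
    (fun n ⟨_, hn⟩ => ⟨0, succ n hn⟩) n
  exact h

/-- Variable 0 is made a dummy, so that one bounded matrix gives equivalent Σ⁰₁ and Π⁰₁ formulas. -/
theorem ModelsRCA0.bounded_comprehension (hM : M.ModelsRCA0) {P : M.carrier → Prop}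
    (h : Definable false fun x => P (x 0)) : {n | P n} ∈ M.sets := by
  obtain ⟨V, w, K, φ, hb, hφ⟩ :=
    (h.subst (σ := fun _ x => x 1) fun _ => .var 1).exists_formula 2
  have key : ∀ n a, M.Sat V φ (push a (push n (mix K (fun _ => 0) w))) ↔ P n := by
    intro n a
    rw [push_mix, push_mix, hφ]
    rfl
  have hex : ∀ n, M.Sat V φ.ex (push n (mix K (fun _ => 0) w)) ↔ P n := by
    intro n
    change (¬ ∀ a, ¬ M.Sat V φ (push a (push n _))) ↔ _
    simp only [key, not_forall_not]
    exact ⟨fun ⟨_, h⟩ => h, fun h => ⟨0, h⟩⟩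
  have hall : ∀ n, M.Sat V φ.all (push n (mix K (fun _ => 0) w)) ↔ P n := by
    intro n
    change (∀ a, M.Sat V φ (push a (push n _))) ↔ _
    simp only [key]
    exact ⟨fun h => h 0, fun h _ => h⟩
  obtain ⟨X, hX, h⟩ := hM.comprehension φ.ex φ.all ⟨φ, hb rfl, rfl⟩ ⟨φ, hb rfl, rfl⟩ V
    (mix K (fun _ => 0) w) fun n => (hex n).trans (hall n).symm
  have : {n | P n} = X := Set.ext fun n => ((h n).trans (hex n)).symm
  exact this ▸ hX

theorem ModelsACA0.comprehension_definable (hM : M.ModelsACA0) {P : M.carrier → Prop}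
    (h : Definable true fun x => P (x 0)) : {n | P n} ∈ M.sets := by
  obtain ⟨V, w, K, φ, -, hφ⟩ := h.exists_formula 1
  obtain ⟨X, hX, h⟩ := hM.comprehension φ V (mix K (fun _ => 0) w)
  have : {n | P n} = X := Set.ext fun n => by
    rw [h, push_mix, hφ]
    rfl
  exact this ▸ hX

theorem ModelsACA0.arith_induction (hM : M.ModelsACA0) {P : M.carrier → Prop}
    (h : Definable true fun x => P (x 0)) (zero : P 0) (succ : ∀ n, P n → P (n + 1))
    (n : M.carrier) : P n :=
  hM.induction _ (hM.comprehension_definable h) zero succ n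

/-! ### Substituting terms into definable relations -/

theorem Definable.comp₁ {b : Bool} {R : M.carrier → Prop} {s : (ℕ → M.carrier) → M.carrier}
    (h : Definable b fun x => R (x 0)) (hs : IsTerm s) : Definable b fun x => R (s x) :=
  h.subst (σ := fun _ => s) fun _ => hs

theorem Definable.comp₂ {b : Bool} {R : M.carrier → M.carrier → Prop}
    {s t : (ℕ → M.carrier) → M.carrier} (h : Definable b fun x => R (x 0) (x 1))
    (hs : IsTerm s) (ht : IsTerm t) : Definable b fun x => R (s x) (t x) :=
  h.subst (σ := fun i => if i = 0 then s else t) fun i => by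
    split_ifs
    exacts [hs, ht]

theorem Definable.comp₃ {b : Bool} {R : M.carrier → M.carrier → M.carrier → Prop}
    {s t u : (ℕ → M.carrier) → M.carrier} (h : Definable b fun x => R (x 0) (x 1) (x 2))
    (hs : IsTerm s) (ht : IsTerm t) (hu : IsTerm u) : Definable b fun x => R (s x) (t x) (u x) :=
  h.subst (σ := fun i => if i = 0 then s else if i = 1 then t else u) fun i => by
    split_ifs
    exacts [hs, ht, hu]

/-! ### Arithmetic in models of `RCA₀` -/

namespace ModelsRCA0

protected theorem add_zero (hM : M.ModelsRCA0) (a : M.carrier) : a + 0 = a := hM.basic.add_zero a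

protected theorem add_succ (hM : M.ModelsRCA0) (a b : M.carrier) : a + (b + 1) = a + b + 1 :=
  hM.basic.add_succ a b

protected theorem mul_zero (hM : M.ModelsRCA0) (a : M.carrier) : a * 0 = 0 := hM.basic.mul_zero a

protected theorem mul_succ (hM : M.ModelsRCA0) (a b : M.carrier) : a * (b + 1) = a * b + a :=
  hM.basic.mul_succ a b

protected theorem lt_succ (hM : M.ModelsRCA0) (a b : M.carrier) : a < b + 1 ↔ a < b ∨ a = b :=
  hM.basic.lt_succ a b

protected theorem succ_inj (hM : M.ModelsRCA0) {a b : M.carrier} (h : a + 1 = b + 1) : a = b :=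
  hM.basic.succ_inj a b h

protected theorem zero_add (hM : M.ModelsRCA0) (a : M.carrier) : 0 + a = a := by
  refine hM.bounded_induction (P := fun a => 0 + a = a)
    (.eq (.add (.const _) (.var _)) (.var _)) (hM.add_zero 0) (fun n h => ?_) a
  rw [hM.add_succ, h]

protected theorem add_assoc (hM : M.ModelsRCA0) (a b c : M.carrier) :
    a + b + c = a + (b + c) := by
  refine hM.bounded_induction (P := fun c => a + b + c = a + (b + c))
    (.eq (.add (.const _) (.var _)) (.add (.const _) (.add (.const _) (.var _))))
    (by rw [hM.add_zero, hM.add_zero]) (fun n h => ?_) c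
  rw [hM.add_succ, hM.add_succ, hM.add_succ, h]

protected theorem succ_add (hM : M.ModelsRCA0) (a b : M.carrier) : a + 1 + b = a + b + 1 := by
  refine hM.bounded_induction (P := fun b => a + 1 + b = a + b + 1)
    (.eq (.add (.const _) (.var _)) (.add (.add (.const _) (.var _)) (.const _)))
    (by rw [hM.add_zero, hM.add_zero]) (fun n h => ?_) b
  rw [hM.add_succ, hM.add_succ, h]

protected theorem add_comm (hM : M.ModelsRCA0) (a b : M.carrier) : a + b = b + a := by
  refine hM.bounded_induction (P := fun b => a + b = b + a)
    (.eq (.add (.const _) (.var _)) (.add (.var _) (.const _)))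
    (by rw [hM.add_zero, hM.zero_add]) (fun n h => ?_) b
  rw [hM.add_succ, hM.succ_add, h]

protected theorem zero_mul (hM : M.ModelsRCA0) (a : M.carrier) : 0 * a = 0 := by
  refine hM.bounded_induction (P := fun a => 0 * a = 0)
    (.eq (.mul (.const _) (.var _)) (.const _)) (hM.mul_zero 0) (fun n h => ?_) a
  rw [hM.mul_succ, h, hM.add_zero]

protected theorem mul_add (hM : M.ModelsRCA0) (a b c : M.carrier) :
    a * (b + c) = a * b + a * c := by
  refine hM.bounded_induction (P := fun c => a * (b + c) = a * b + a * c)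
    (.eq (.mul (.const _) (.add (.const _) (.var _)))
      (.add (.const _) (.mul (.const _) (.var _))))
    (by rw [hM.add_zero, hM.mul_zero, hM.add_zero]) (fun n h => ?_) c
  rw [hM.add_succ, hM.mul_succ, hM.mul_succ, h, hM.add_assoc]

protected theorem mul_assoc (hM : M.ModelsRCA0) (a b c : M.carrier) :
    a * b * c = a * (b * c) := by
  refine hM.bounded_induction (P := fun c => a * b * c = a * (b * c))
    (.eq (.mul (.const _) (.var _)) (.mul (.const _) (.mul (.const _) (.var _))))
    (by rw [hM.mul_zero, hM.mul_zero, hM.mul_zero]) (fun n h => ?_) c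
  rw [hM.mul_succ, hM.mul_succ, hM.mul_add, h]

protected theorem succ_mul (hM : M.ModelsRCA0) (a b : M.carrier) : (a + 1) * b = a * b + b := by
  refine hM.bounded_induction (P := fun b => (a + 1) * b = a * b + b)
    (.eq (.mul (.const _) (.var _)) (.add (.mul (.const _) (.var _)) (.var _)))
    (by rw [hM.mul_zero, hM.mul_zero, hM.add_zero]) (fun n h => ?_) b
  rw [hM.mul_succ, hM.mul_succ, h, ← hM.add_assoc, ← hM.add_assoc, hM.add_assoc (a * n) n,
    hM.add_comm n, ← hM.add_assoc]

protected theorem mul_comm (hM : M.ModelsRCA0) (a b : M.carrier) : a * b = b * a := by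
  refine hM.bounded_induction (P := fun b => a * b = b * a)
    (.eq (.mul (.const _) (.var _)) (.mul (.var _) (.const _)))
    (by rw [hM.mul_zero, hM.zero_mul]) (fun n h => ?_) b
  rw [hM.mul_succ, hM.succ_mul, h]

protected theorem mul_one (hM : M.ModelsRCA0) (a : M.carrier) : a * 1 = a := by
  have := hM.mul_succ a 0
  rwa [hM.zero_add, hM.mul_zero, hM.zero_add] at this

protected theorem add_right_cancel (hM : M.ModelsRCA0) {a b c : M.carrier} (h : a + c = b + c) :
    a = b := by
  refine hM.bounded_induction (P := fun c => a + c = b + c → a = b)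
    (.imp (.eq (.add (.const _) (.var _)) (.add (.const _) (.var _))) (.eq (.const _) (.const _)))
    (fun h => ?_) (fun n ih h => ih ?_) c h
  · rwa [hM.add_zero, hM.add_zero] at h
  · rw [hM.add_succ, hM.add_succ] at h
    exact hM.succ_inj h

protected theorem eq_zero_or_succ (hM : M.ModelsRCA0) (a : M.carrier) :
    a = 0 ∨ ∃ b, a = b + 1 := by
  obtain ⟨b, hb⟩ := hM.sigma_induction (P := fun b a => a = 0 ∨ a = b + 1)
    (.or (.eq (.var _) (.const _)) (.eq (.var _) (.add (.var _) (.const _))))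
    ⟨0, .inl rfl⟩ (fun n _ => ⟨n, .inr rfl⟩) a
  exact hb.imp_right fun h => ⟨b, h⟩

protected theorem lt_iff (hM : M.ModelsRCA0) (a b : M.carrier) :
    a < b ↔ ∃ c, b = a + c + 1 := by
  constructor
  · intro h
    -- With `a < b` placed inside the existential quantifier, the induction statement is Σ⁰₁.
    obtain ⟨c, hc⟩ := hM.sigma_induction (P := fun c b => a < b → b = a + c + 1)
      (.imp (.lt (.const _) (.var _))
        (.eq (.var _) (.add (.add (.const _) (.var _)) (.const _))))
      ⟨0, fun h => (hM.basic.not_lt_zero a h).elim⟩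
      (fun n ⟨c, hc⟩ => by
        by_cases h : a < n
        · exact ⟨c + 1, fun _ => by rw [hM.add_succ, ← hc h]⟩
        · refine ⟨0, fun h' => ?_⟩
          rw [hM.add_zero, ((hM.lt_succ a n).1 h').resolve_left h]) b
    exact ⟨c, hc h⟩
  · rintro ⟨c, rfl⟩
    refine hM.bounded_induction (P := fun c => a < a + c + 1)
      (.lt (.const _) (.add (.add (.const _) (.var _)) (.const _)))
      ((hM.lt_succ _ _).2 (.inr (hM.add_zero a).symm))
      (fun n h => (hM.lt_succ _ _).2 (.inl ?_)) c
    rwa [hM.add_succ]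

protected theorem lt_irrefl (hM : M.ModelsRCA0) (a : M.carrier) : ¬ a < a := by
  rw [hM.lt_iff]
  rintro ⟨c, hc⟩
  rw [hM.add_assoc, hM.add_comm] at hc
  refine hM.basic.succ_ne_zero c (hM.add_right_cancel (c := a) ?_)
  exact hc.symm.trans (hM.zero_add a).symm

protected theorem lt_trans (hM : M.ModelsRCA0) {a b c : M.carrier} (h : a < b) (h' : b < c) :
    a < c := by
  rw [hM.lt_iff] at *
  obtain ⟨d, rfl⟩ := h
  obtain ⟨e, rfl⟩ := h'
  exact ⟨d + 1 + e, by
    simp only [hM.add_assoc]⟩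

protected theorem lt_trichotomy (hM : M.ModelsRCA0) (a b : M.carrier) : a < b ∨ a = b ∨ b < a := by
  refine hM.bounded_induction (P := fun b => a < b ∨ a = b ∨ b < a)
    (.or (.lt (.const _) (.var _)) (.or (.eq (.const _) (.var _)) (.lt (.var _) (.const _))))
    ?_ (fun n h => ?_) b
  · rcases hM.eq_zero_or_succ a with h | ⟨b, h⟩
    · exact .inr (.inl h)
    · exact .inr (.inr ((hM.lt_iff _ _).2 ⟨b, by rwa [hM.zero_add]⟩))
  · rcases h with h | h | h
    · exact .inl ((hM.lt_succ _ _).2 (.inl h))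
    · exact .inl ((hM.lt_succ _ _).2 (.inr h))
    · obtain ⟨c, rfl⟩ := (hM.lt_iff _ _).1 h
      rcases hM.eq_zero_or_succ c with rfl | ⟨d, rfl⟩
      · exact .inr (.inl (by rw [hM.add_zero]))
      · refine .inr (.inr ((hM.lt_iff _ _).2 ⟨d, ?_⟩))
        rw [hM.add_succ, hM.succ_add n d]

end ModelsRCA0

variable [hM : Fact M.ModelsRCA0]

/-! ### The ordered semiring of numbers -/

instance : CommSemiring M.carrier where
  add_assoc := hM.out.add_assoc
  zero_add := hM.out.zero_add
  add_zero := hM.out.add_zero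
  add_comm := hM.out.add_comm
  left_distrib := hM.out.mul_add
  right_distrib a b c := by
    rw [hM.out.mul_comm, hM.out.mul_add, hM.out.mul_comm c, hM.out.mul_comm c]
  zero_mul := hM.out.zero_mul
  mul_zero := hM.out.mul_zero
  mul_assoc := hM.out.mul_assoc
  one_mul a := by rw [hM.out.mul_comm, hM.out.mul_one]
  mul_one := hM.out.mul_one
  mul_comm := hM.out.mul_comm
  nsmul := nsmulRec

noncomputable instance : LinearOrder M.carrier where
  le a b := a < b ∨ a = b
  le_refl _ := .inr rfl
  le_trans a b c := by
    rintro (h | rfl) (h' | rfl)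
    exacts [.inl (hM.out.lt_trans h h'), .inl h, .inl h', .inr rfl]
  lt_iff_le_not_ge a b := by
    refine ⟨fun h => ⟨.inl h, ?_⟩, ?_⟩
    · rintro (h' | rfl)
      exacts [hM.out.lt_irrefl _ (hM.out.lt_trans h h'), hM.out.lt_irrefl _ h]
    · rintro ⟨h | rfl, h'⟩
      exacts [h, (h' (.inr rfl)).elim]
  le_antisymm a b := by
    rintro (h | rfl) (h' | h')
    exacts [(hM.out.lt_irrefl _ (hM.out.lt_trans h h')).elim, h'.symm, rfl, rfl]
  le_total a b := by
    rcases hM.out.lt_trichotomy a b with h | h | h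
    exacts [.inl (.inl h), .inl (.inr h), .inr (.inl h)]
  toDecidableLE := Classical.decRel _

instance : Nontrivial M.carrier :=
  ⟨0, 1, fun h => hM.out.basic.succ_ne_zero 0 ((zero_add (1 : M.carrier)).trans h.symm)⟩

instance : IsCancelAdd M.carrier where
  add_left_cancel a b c h := hM.out.add_right_cancel (c := a) (by rwa [add_comm b, add_comm c])
  add_right_cancel a b c h := hM.out.add_right_cancel h

theorem lt_iff_exists_add_one {a b : M.carrier} : a < b ↔ ∃ c, b = a + c + 1 := hM.out.lt_iff a b

theorem lt_add_one_iff_le {a b : M.carrier} : a < b + 1 ↔ a ≤ b := hM.out.lt_succ a b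

instance : CanonicallyOrderedAdd M.carrier where
  exists_add_of_le {a b} h := by
    obtain ⟨c, h⟩ := lt_iff_exists_add_one.1 (lt_add_one_iff_le.2 h)
    exact ⟨c, add_right_cancel h⟩
  le_add_self a b := lt_add_one_iff_le.1 (lt_iff_exists_add_one.2 ⟨b, by rw [add_comm a b]⟩)
  le_self_add a b := lt_add_one_iff_le.1 (lt_iff_exists_add_one.2 ⟨b, rfl⟩)

instance : IsOrderedAddMonoid M.carrier where
  add_le_add_left a b h c := by
    obtain ⟨d, rfl⟩ := exists_add_of_le h
    rw [add_right_comm]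
    exact le_self_add

theorem mul_lt_mul_of_pos' {a b c : M.carrier} (hc : 0 < c) (h : a < b) : c * a < c * b := by
  obtain ⟨d, rfl⟩ := lt_iff_exists_add_one.1 h
  obtain ⟨e, rfl⟩ := lt_iff_exists_add_one.1 hc
  exact lt_iff_exists_add_one.2 ⟨e * d + d + e, by ring⟩

instance : IsStrictOrderedRing M.carrier where
  le_of_add_le_add_left a b c h := by
    obtain ⟨d, h⟩ := exists_add_of_le h
    rw [add_assoc] at h
    rw [add_left_cancel h]
    exact le_self_add
  zero_le_one := zero_le
  mul_lt_mul_of_pos_left _ hc _ _ h := mul_lt_mul_of_pos' hc h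
  mul_lt_mul_of_pos_right c hc a b h := by
    simpa only [mul_comm _ c] using mul_lt_mul_of_pos' hc h

theorem one_le_of_pos {a : M.carrier} (h : 0 < a) : 1 ≤ a := by
  obtain ⟨c, rfl⟩ := lt_iff_exists_add_one.1 h
  exact le_add_self

theorem add_one_le_iff_lt {a b : M.carrier} : a + 1 ≤ b ↔ a < b := by
  rw [← lt_add_one_iff_le, add_lt_add_iff_right]

theorem le_mul_right_of_pos {a b : M.carrier} (h : 0 < b) : a ≤ a * b :=
  le_mul_of_one_le_right zero_le (one_le_of_pos h)

theorem dvd_of_dvd_add {a x y : M.carrier} (hx : a ∣ x) (hxy : a ∣ x + y) : a ∣ y := by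
  obtain ⟨p, rfl⟩ := hx
  obtain ⟨q, hq⟩ := hxy
  rcases le_total p q with h | h
  · obtain ⟨d, rfl⟩ := exists_add_of_le h
    exact ⟨d, add_left_cancel (hq.trans (mul_add _ _ _))⟩
  -- Without subtraction: `q ≤ p` gives `a * p + y = a * q ≤ a * p`, which forces `y = 0`.
  · have h' : a * p + y ≤ a * p + 0 := by
      rw [hq, add_zero]
      exact mul_le_mul_right h a
    rw [nonpos_iff_eq_zero.1 (le_of_add_le_add_left h')]
    exact dvd_zero a

/-! ### Pairing -/

omit hM in
theorem pair_def (i j : M.carrier) : M.pair i j = (i + j) * (i + j) + i := rfl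

theorem self_le_sq (a : M.carrier) : a ≤ a * a := by
  rcases eq_zero_or_pos a with rfl | h
  · exact zero_le
  · exact le_mul_right_of_pos h

theorem left_le_pair (i j : M.carrier) : i ≤ M.pair i j := le_add_self

theorem right_le_pair (i j : M.carrier) : j ≤ M.pair i j :=
  (le_add_self.trans (self_le_sq (i + j))).trans le_self_add

theorem pair_le_pair {i i' j j' : M.carrier} (hi : i ≤ i') (hj : j ≤ j') :
    M.pair i j ≤ M.pair i' j' := by
  rw [pair_def, pair_def]
  gcongr

/-- With `s = i + j`, the code lies between `s²` and `s² + s < (s + 1)²`, so it determines `s`, and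
then `i`. -/
theorem pair_inj {i j i' j' : M.carrier} : M.pair i j = M.pair i' j' ↔ i = i' ∧ j = j' := by
  have key : ∀ {i j i' j' : M.carrier}, i + j < i' + j' → M.pair i j < M.pair i' j' := by
    intro i j i' j' h
    have h₁ := add_one_le_iff_lt.2 h
    calc M.pair i j ≤ (i + j) * (i + j) + (i + j) := by rw [pair_def]; gcongr; exact le_self_add
      _ < (i + j) * (i + j) + (i + j) + 1 := lt_add_one_iff_le.2 le_rfl
      _ ≤ (i + j) * (i + j) + (i + j) + 1 + (i + j) := le_self_add
      _ = (i + j + 1) * (i + j + 1) := by ring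
      _ ≤ (i' + j') * (i' + j') := by gcongr
      _ ≤ M.pair i' j' := le_self_add
  refine ⟨fun h => ?_, fun ⟨h, h'⟩ => h ▸ h' ▸ rfl⟩
  rcases lt_trichotomy (i + j) (i' + j') with h' | h' | h'
  · exact absurd h (key h').ne
  · rw [pair_def, pair_def, h'] at h
    have := add_left_cancel h
    subst this
    exact ⟨rfl, add_left_cancel h'⟩
  · exact absurd h.symm (key h').ne

theorem Definable.le {b : Bool} {s t : (ℕ → M.carrier) → M.carrier} (hs : IsTerm s)
    (ht : IsTerm t) : Definable b fun x => s x ≤ t x :=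
  (Definable.lt hs ht).or (.eq hs ht)

/-! ### Finite set codes -/

theorem Definable.dvd {b : Bool} {s t : (ℕ → M.carrier) → M.carrier} (hs : IsTerm s)
    (ht : IsTerm t) : Definable b fun x => s x ∣ t x := by
  refine (Definable.bex (R := fun q x => t x = s x * q) (ht.add (.const 1))
    (.eq (ht.subst fun i => .var (i + 1))
      (.mul (hs.subst fun i => .var (i + 1)) (.var 0)))).of_iff fun x => ?_
  constructor
  · rintro ⟨q, hq⟩
    -- A quotient is at most the dividend only for a positive divisor; for divisor 0 the quotient is
    -- chosen to be 0.
    rcases eq_zero_or_pos (s x) with h | h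
    · exact ⟨0, lt_add_one_iff_le.2 zero_le, by rw [hq, h, zero_mul, zero_mul]⟩
    · refine ⟨q, lt_add_one_iff_le.2 ?_, hq⟩
      rw [hq, mul_comm]
      exact le_mul_right_of_pos h
  · rintro ⟨q, -, hq⟩
    exact ⟨q, hq⟩

/-- Taking the needed instance of induction as a hypothesis lets the same argument serve bounded
relations in `RCA₀` and arithmetical ones in `ACA₀`. -/
theorem exists_least_of_induction {P : M.carrier → Prop}
    (ind : (∀ d, d < 0 → ¬ P d) → (∀ n, (∀ d, d < n → ¬ P d) → ∀ d, d < n + 1 → ¬ P d) →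
      ∀ n d, d < n → ¬ P d) {a : M.carrier} (ha : P a) : ∃ c, P c ∧ ∀ d, d < c → ¬ P d := by
  by_contra! h
  refine ind (fun d hd => (not_lt_zero hd).elim) (fun n ih d hd hPd => ?_) (a + 1) a
    (lt_add_one_iff_le.2 le_rfl) ha
  rcases (lt_add_one_iff_le.1 hd).lt_or_eq with hd | rfl
  · exact ih d hd hPd
  · obtain ⟨d', hd', h'⟩ := h _ hPd
    exact ih d' hd' h'

theorem exists_least {P : M.carrier → Prop} (hP : Definable false fun x => P (x 0))
    {a : M.carrier} (ha : P a) : ∃ c, P c ∧ ∀ d, d < c → ¬ P d :=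
  exists_least_of_induction (hM.out.bounded_induction (P := fun n => ∀ d, d < n → ¬ P d)
    (.ball (.var 0) hP.not)) ha

theorem ModelsACA0.exists_least (hA : M.ModelsACA0) {P : M.carrier → Prop}
    (hP : Definable true fun x => P (x 0)) {a : M.carrier} (ha : P a) :
    ∃ c, P c ∧ ∀ d, d < c → ¬ P d :=
  exists_least_of_induction (hA.arith_induction (P := fun n => ∀ d, d < n → ¬ P d)
    (.ball (.var 0) hP.not)) ha

theorem codeMem_pair {i k m n : M.carrier} :
    M.CodeMem i (M.pair k (M.pair m n)) ↔ i < k ∧ m * (i + 1) + 1 ∣ n := by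
  constructor
  · rintro ⟨k', m', n', h, hi, q, hq⟩
    obtain ⟨rfl, h'⟩ := pair_inj.1 h
    obtain ⟨rfl, rfl⟩ := pair_inj.1 h'
    exact ⟨hi, q, hq⟩
  · rintro ⟨hi, q, hq⟩
    exact ⟨k, m, n, rfl, hi, q, hq⟩

theorem CodeMem.lt {i c : M.carrier} (h : M.CodeMem i c) : i < c := by
  obtain ⟨k, m, n, rfl, hi, -⟩ := h
  exact lt_of_lt_of_le hi (left_le_pair _ _)

/-- The components of a triple are at most its code, so decoding needs only bounded quantifiers. -/
theorem exists_triple_iff {c : M.carrier} {R : M.carrier → M.carrier → M.carrier → Prop} :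
    (∃ k m n, c = M.pair k (M.pair m n) ∧ R k m n) ↔
      ∃ k, k < c + 1 ∧ ∃ m, m < c + 1 ∧ ∃ n, n < c + 1 ∧
        (c = M.pair k (M.pair m n) ∧ R k m n) := by
  simp only [lt_add_one_iff_le]
  constructor
  · rintro ⟨k, m, n, rfl, h⟩
    exact ⟨k, left_le_pair _ _, m, (left_le_pair _ _).trans (right_le_pair _ _), n,
      (right_le_pair _ _).trans (right_le_pair _ _), rfl, h⟩
  · rintro ⟨k, -, m, -, n, -, h⟩
    exact ⟨k, m, n, h⟩

theorem Definable.isTriple {b : Bool} {t : (ℕ → M.carrier) → M.carrier} (ht : IsTerm t) :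
    Definable b fun x => M.IsTriple (t x) := by
  -- The conjunct `x 0 = x 0` is a filler that gives the shape of `exists_triple_iff`.
  refine Definable.comp₁ (Definable.of_iff (P := fun x : ℕ → M.carrier =>
    ∃ k, k < x 0 + 1 ∧ ∃ m, m < x 0 + 1 ∧ ∃ n, n < x 0 + 1 ∧
      (x 0 = M.pair k (M.pair m n) ∧ x 0 = x 0)) ?_ fun x => ?_) ht
  · exact .bex (.add (.var _) (.const _)) (.bex (.add (.var _) (.const _))
      (.bex (.add (.var _) (.const _))
        (.and (.eq (.var _) (.pair (.var _) (.pair (.var _) (.var _)))) (.eq (.var _) (.var _)))))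
  · rw [← exists_triple_iff (R := fun _ _ _ => x 0 = x 0)]
    simp only [and_true]
    rfl

theorem Definable.codeMem {b : Bool} {s t : (ℕ → M.carrier) → M.carrier} (hs : IsTerm s)
    (ht : IsTerm t) : Definable b fun x => M.CodeMem (s x) (t x) := by
  refine Definable.comp₂ (Definable.of_iff (P := fun x : ℕ → M.carrier =>
    ∃ k, k < x 1 + 1 ∧ ∃ m, m < x 1 + 1 ∧ ∃ n, n < x 1 + 1 ∧
      (x 1 = M.pair k (M.pair m n) ∧ (x 0 < k ∧ m * (x 0 + 1) + 1 ∣ n))) ?_ fun x => ?_) hs ht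
  · exact .bex (.add (.var _) (.const _)) (.bex (.add (.var _) (.const _))
      (.bex (.add (.var _) (.const _))
        (.and (.eq (.var _) (.pair (.var _) (.pair (.var _) (.var _))))
          (.and (.lt (.var _) (.var _)) (.dvd (.add (.mul (.var _) (.add (.var _) (.const _)))
            (.const _)) (.var _))))))
  · rw [← exists_triple_iff (R := fun k m n => x 0 < k ∧ m * (x 0 + 1) + 1 ∣ n)]
    rfl

/-- Minimality concerns only smaller competitors, and members lie below their codes, so both
quantifiers can be bounded by the code. -/
theorem Definable.isFiniteSetCode {b : Bool} {t : (ℕ → M.carrier) → M.carrier} (ht : IsTerm t) :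
    Definable b fun x => M.IsFiniteSetCode (t x) := by
  refine Definable.comp₁ (Definable.of_iff (P := fun x : ℕ → M.carrier =>
    M.IsTriple (x 0) ∧ ∀ c, c < x 0 → M.IsTriple c →
      ¬ ∀ i, i < x 0 → (M.CodeMem i c ↔ M.CodeMem i (x 0))) ?_ fun x => ?_) ht
  · exact .and (.isTriple (.var _)) (.ball (.var _) (.imp (.isTriple (.var _))
      (.not (.ball (.var _) (.iff (.codeMem (.var _) (.var _)) (.codeMem (.var _) (.var _)))))))
  · refine and_congr_right fun _ => ⟨fun h c hc hT hi => h c hT (fun i => ?_) hc,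
      fun h c hT hi hc => h c hc hT fun i _ => hi i⟩
    by_cases hix : i < x 0
    · exact hi i hix
    · exact ⟨fun h => (hix (h.lt.trans hc)).elim, fun h => (hix h.lt).elim⟩

theorem IsFiniteSetCode.eq {c d : M.carrier} (hc : M.IsFiniteSetCode c)
    (hd : M.IsFiniteSetCode d) (h : ∀ i, M.CodeMem i c ↔ M.CodeMem i d) : c = d :=
  le_antisymm (not_lt.1 (hc.2 d hd.1 fun i => (h i).symm)) (not_lt.1 (hd.2 c hc.1 h))

theorem exists_common_multiple (k : M.carrier) :
    ∃ m : M.carrier, 0 < m ∧ ∀ d, d < k → 0 < d → d ∣ m := by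
  refine hM.out.sigma_induction (P := fun m k => 0 < m ∧ ∀ d, d < k → 0 < d → d ∣ m)
    (.and (.lt (.const _) (.var _)) (.ball (.var _) (.imp (.lt (.const _) (.var _))
      (.dvd (.var _) (.var _)))))
    ⟨1, zero_lt_one, fun d hd => (not_lt_zero hd).elim⟩ ?_ k
  rintro n ⟨m, hm, h⟩
  -- Multiplying by `n = 0` would destroy positivity, and no positive divisor is added in that case.
  rcases eq_zero_or_pos n with rfl | hn
  · refine ⟨m, hm, fun d hd hd' => ?_⟩
    exact absurd hd' (not_lt.2 (lt_add_one_iff_le.1 hd))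
  · refine ⟨m * n, mul_pos hm hn, fun d hd hd' => ?_⟩
    rcases (lt_add_one_iff_le.1 hd).lt_or_eq with hd | rfl
    · exact (h d hd hd').mul_right n
    · exact dvd_mul_left _ _

/-- This is the coprimality of the β-function moduli: two of them differ by `m` times a positive `d
< k`, and each is coprime to `m`, which `d` divides. -/
theorem dvd_of_dvd_mul_of_common_multiple {k m i j n : M.carrier}
    (hm : ∀ d, d < k → 0 < d → d ∣ m) (hi : i < k) (hj : j < k) (hij : i ≠ j)
    (h : m * (i + 1) + 1 ∣ n * (m * (j + 1) + 1)) : m * (i + 1) + 1 ∣ n := by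
  -- The factor `m` cancels because `m * y * (i + 1) + y` is the modulus times `y`.
  have coprime : ∀ y, m * (i + 1) + 1 ∣ m * y → m * (i + 1) + 1 ∣ y := by
    intro y hy
    refine dvd_of_dvd_add (x := m * y * (i + 1)) (hy.mul_right _) ⟨y, by ring⟩
  -- Here `d` is the distance between `i` and `j`.
  obtain ⟨d, hd, hdk, hdvd⟩ : ∃ d, 0 < d ∧ d < k ∧ m * (i + 1) + 1 ∣ m * (n * d) := by
    rcases lt_or_gt_of_ne hij with hlt | hlt
    · obtain ⟨d, rfl⟩ := exists_add_of_le hlt.le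
      refine ⟨d, pos_of_lt_add_right hlt, lt_of_le_of_lt le_add_self hj, ?_⟩
      refine dvd_of_dvd_add (x := n * (m * (i + 1) + 1)) (dvd_mul_left _ _) ?_
      convert h using 1
      ring
    · obtain ⟨d, rfl⟩ := exists_add_of_le hlt.le
      refine ⟨d, pos_of_lt_add_right hlt, lt_of_le_of_lt le_add_self hi, ?_⟩
      refine dvd_of_dvd_add h ⟨n, ?_⟩
      ring
  obtain ⟨e, he⟩ := hm d hdk hd
  refine coprime n ?_
  have := (coprime _ hdvd).mul_right e
  rwa [mul_assoc, ← he, mul_comm n] at this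

/-- The number `n` is the product of the moduli `m * (i + 1) + 1` over `i ∈ D` below `k`, built by
Σ⁰₁ induction on an upper bound `j` for the indices used. -/
theorem exists_codes_below {D : Set M.carrier} (hD : D ∈ M.sets) (k : M.carrier) :
    ∃ m n : M.carrier, ∀ i, i < k → (m * (i + 1) + 1 ∣ n ↔ i ∈ D) := by
  obtain ⟨m, hm, hdvd⟩ := exists_common_multiple k
  -- As `m > 0`, each modulus exceeds 1, so the empty product 1 codes the empty set.
  have hpos : ∀ i : M.carrier, ¬ m * (i + 1) + 1 ∣ 1 := by
    rintro i ⟨q, hq⟩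
    have h0 : 0 < q := by
      rw [pos_iff_ne_zero]
      rintro rfl
      simp at hq
    have h1 : 0 < m * (i + 1) := mul_pos hm (lt_add_one_iff_le.2 zero_le)
    have h2 := le_mul_right_of_pos (a := m * (i + 1) + 1) h0
    rw [← hq] at h2
    exact absurd h2 (not_le.2 (lt_add_of_pos_left 1 h1))
  obtain ⟨n, hn⟩ := hM.out.sigma_induction
    (P := fun n j => ∀ i, i < k → (m * (i + 1) + 1 ∣ n ↔ i < j ∧ i ∈ D))
    (.ball (.const _) (.iff (.dvd (.add (.mul (.const _) (.add (.var _) (.const _)))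
            (.const _)) (.var _)) (.and (.lt (.var _) (.var _)) (.mem hD (.var _)))))
    ⟨1, fun i _ => ⟨fun h => (hpos i h).elim, fun h => (not_lt_zero h.1).elim⟩⟩ (by
      rintro j ⟨n, hn⟩
      by_cases hj : j < k ∧ j ∈ D
      · refine ⟨n * (m * (j + 1) + 1), fun i hi => ?_⟩
        by_cases hij : i = j
        · subst hij
          exact ⟨fun _ => ⟨lt_add_one_iff_le.2 le_rfl, hj.2⟩, fun _ => dvd_mul_left _ _⟩
        · have : m * (i + 1) + 1 ∣ n * (m * (j + 1) + 1) ↔ m * (i + 1) + 1 ∣ n :=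
            ⟨dvd_of_dvd_mul_of_common_multiple hdvd hi hj.1 hij, fun h => h.mul_right _⟩
          rw [this, hn i hi, lt_add_one_iff_le, lt_iff_le_and_ne]
          tauto
      · refine ⟨n, fun i hi => ?_⟩
        rw [hn i hi, lt_add_one_iff_le, le_iff_lt_or_eq]
        refine and_congr_left fun hiD => ⟨.inl, ?_⟩
        rintro (h | rfl)
        exacts [h, (hj ⟨hi, hiD⟩).elim]) k
  exact ⟨m, n, fun i hi => by rw [hn i hi]; exact and_iff_right hi⟩

theorem exists_isFiniteSetCode {D : M.carrier → Prop} (hD : Definable false fun x => D (x 0))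
    {k : M.carrier} (hk : ∀ i, D i → i < k) :
    ∃ c, M.IsFiniteSetCode c ∧ ∀ i, M.CodeMem i c ↔ D i := by
  obtain ⟨m, n, h⟩ := exists_codes_below (hM.out.bounded_comprehension hD) k
  -- A bounded form of "`c` is a triple with exactly the members of `D`", to which the least number
  -- principle applies.
  let P : M.carrier → Prop := fun c => M.IsTriple c ∧
    (∀ i, i < c → M.CodeMem i c → D i) ∧ ∀ i, i < k → D i → M.CodeMem i c
  have hP : ∀ c, P c ↔ M.IsTriple c ∧ ∀ i, M.CodeMem i c ↔ D i := fun c =>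
    and_congr_right fun _ => ⟨fun h i => ⟨fun hi => h.1 i hi.lt hi, fun hi => h.2 i (hk i hi) hi⟩,
      fun h => ⟨fun i _ => (h i).1, fun i _ => (h i).2⟩⟩
  obtain ⟨c, hc, hmin⟩ := exists_least (P := P) (a := M.pair k (M.pair m n))
    (.and (.isTriple (.var _)) (.and (.ball (.var _) (.imp (.codeMem (.var _) (.var _)) hD))
      (.ball (.const _) (.imp hD (.codeMem (.var _) (.var _))))))
    ((hP _).2 ⟨⟨k, m, n, rfl⟩, fun i => by
      rw [codeMem_pair]
      exact ⟨fun hi => (h i hi.1).1 hi.2, fun hi => ⟨hk i hi, (h i (hk i hi)).2 hi⟩⟩⟩)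
  rw [hP] at hc
  refine ⟨c, ⟨hc.1, fun c' hT hc' hlt => hmin c' hlt ((hP c').2 ⟨hT, fun i => ?_⟩)⟩, hc.2⟩
  rw [hc', hc.2]

/-! ### From the principle for `2` to `Σ⁰₁` comprehension -/

theorem eq_zero_or_one_of_lt_two {a : M.carrier} (h : a < 1 + 1) : a = 0 ∨ a = 1 := by
  rcases eq_zero_or_pos a with h' | h'
  · exact .inl h'
  · exact .inr (le_antisymm (lt_add_one_iff_le.1 h) (one_le_of_pos h'))

/-- `y` is a member of the sequence of length `l` whose `n`th term is `1` if `P a n` for some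
`a < l`, and `0` otherwise. -/
def StageMem (P : M.carrier → M.carrier → Prop) (l y : M.carrier) : Prop :=
  ∃ n, n < l ∧ ∃ b, b < 1 + 1 ∧ (y = M.pair n b ∧ (b = 1 ↔ ∃ a, a < l ∧ P a n))

omit hM in
theorem Definable.stageMem {P : M.carrier → M.carrier → Prop}
    (hP : Definable false fun x => P (x 0) (x 1)) {s t : (ℕ → M.carrier) → M.carrier}
    (hs : IsTerm s) (ht : IsTerm t) : Definable false fun x => StageMem P (s x) (t x) :=
  Definable.comp₂ (R := StageMem P) (.bex (.var _) (.bex (.const _)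
    (.and (.eq (.var _) (.pair (.var _) (.var _)))
      (.iff (.eq (.var _) (.const _)) (.bex (.var _) (hP.comp₂ (.var _) (.var _))))))) hs ht

theorem stageMem_pair {P : M.carrier → M.carrier → Prop} {l n b : M.carrier} :
    StageMem P l (M.pair n b) ↔ n < l ∧ b < 1 + 1 ∧ (b = 1 ↔ ∃ a, a < l ∧ P a n) := by
  constructor
  · rintro ⟨n', hn, b', hb, h, h'⟩
    obtain ⟨rfl, rfl⟩ := pair_inj.1 h
    exact ⟨hn, hb, h'⟩
  · rintro ⟨hn, hb, h⟩
    exact ⟨n, hn, b, hb, rfl, h⟩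

theorem exists_stageMem (P : M.carrier → M.carrier → Prop) {l n : M.carrier} (hn : n < l) :
    ∃ b, StageMem P l (M.pair n b) := by
  by_cases h : ∃ a, a < l ∧ P a n
  · exact ⟨1, stageMem_pair.2 ⟨hn, lt_add_one_iff_le.2 le_rfl, iff_of_true rfl h⟩⟩
  · exact ⟨0, stageMem_pair.2 ⟨hn, lt_add_one_iff_le.2 zero_le, iff_of_false zero_ne_one h⟩⟩

theorem stageMem_unique {P : M.carrier → M.carrier → Prop} {l n b b' : M.carrier}
    (h : StageMem P l (M.pair n b)) (h' : StageMem P l (M.pair n b')) : b = b' := by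
  rw [stageMem_pair] at h h'
  have := h.2.2.trans h'.2.2.symm
  rcases eq_zero_or_one_of_lt_two h.2.1 with rfl | rfl
  · rcases eq_zero_or_one_of_lt_two h'.2.1 with rfl | rfl
    exacts [rfl, this.2 rfl]
  · exact (this.1 rfl).symm

theorem StageMem.lt {P : M.carrier → M.carrier → Prop} {l y : M.carrier} (h : StageMem P l y) :
    y < M.pair l (1 + 1) + 1 := by
  obtain ⟨n, hn, b, hb, rfl, -⟩ := h
  exact lt_add_one_iff_le.2 (pair_le_pair hn.le hb.le)

/-- `s` is the code of the sequence of length `l` approximating `{n | ∃ a, P a n}`. -/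
def IsStage (P : M.carrier → M.carrier → Prop) (l s : M.carrier) : Prop :=
  M.IsFiniteSetCode s ∧ ∀ y, M.CodeMem y s ↔ StageMem P l y

theorem exists_isStage {P : M.carrier → M.carrier → Prop}
    (hP : Definable false fun x => P (x 0) (x 1)) (l : M.carrier) : ∃ s, IsStage P l s :=
  exists_isFiniteSetCode (.stageMem hP (.const l) (.var 0)) fun _ => StageMem.lt

/-- If `s < l`, the stage would have a term at index `s`, and the corresponding pair would be a
member of `s` that is not below `s`. The bound makes the set of stages both boundedly definable and
unbounded. -/
theorem IsStage.length_le {P : M.carrier → M.carrier → Prop} {l s : M.carrier}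
    (h : IsStage P l s) : l ≤ s := by
  by_contra! hs
  obtain ⟨b, hb⟩ := exists_stageMem P hs
  exact absurd ((h.2 _).2 hb).lt (not_lt.2 (left_le_pair _ _))

theorem IsStage.isSeqBelow {P : M.carrier → M.carrier → Prop} {l s : M.carrier}
    (h : IsStage P l s) : M.IsSeqBelow (M.add M.one M.one) s := by
  refine ⟨⟨h.1, fun x hx => ?_, fun i j j' hj hj' => ?_, l, fun i => ⟨fun hi => ?_, ?_⟩⟩,
    fun i j hj => ?_⟩
  · obtain ⟨n, -, b, -, hx, -⟩ := (h.2 _).1 hx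
    exact ⟨n, b, hx⟩
  · exact stageMem_unique ((h.2 _).1 hj) ((h.2 _).1 hj')
  · obtain ⟨b, hb⟩ := exists_stageMem P hi
    exact ⟨b, (h.2 _).2 hb⟩
  · rintro ⟨j, hj⟩
    exact (stageMem_pair.1 ((h.2 _).1 hj)).1
  · exact (stageMem_pair.1 ((h.2 _).1 hj)).2.1

theorem sigma_comprehension_of_principle (h : M.InitialSegmentPrinciple (M.add M.one M.one))
    {P : M.carrier → M.carrier → Prop} (hP : Definable false fun x => P (x 0) (x 1)) :
    {n | ∃ a, P a n} ∈ M.sets := by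
  have hS : {s | ∃ l, IsStage P l s} ∈ M.sets := by
    -- The bound on `y` is a sum, so it covers the members of the code as well as those of the
    -- stage.
    refine hM.out.bounded_comprehension (Definable.of_iff (P := fun x : ℕ → M.carrier =>
      ∃ l, l < x 0 + 1 ∧ (M.IsFiniteSetCode (x 0) ∧ ∀ y, y < x 0 + (M.pair l (1 + 1) + 1) →
        (M.CodeMem y (x 0) ↔ StageMem P l y))) ?_ fun x => ?_)
    · exact .bex (.add (.var _) (.const _)) (.and (.isFiniteSetCode (.var _))
        (.ball (.add (.var _) (.add (.pair (.var _) (.const _)) (.const _)))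
          (.iff (.codeMem (.var _) (.var _)) (.stageMem hP (.var _) (.var _)))))
    · constructor
      · rintro ⟨l, hl⟩
        exact ⟨l, lt_add_one_iff_le.2 hl.length_le, hl.1, fun y _ => hl.2 y⟩
      · rintro ⟨l, -, hs, hy⟩
        exact ⟨l, hs, fun y => ⟨fun h => (hy y (h.lt.trans_le le_self_add)).1 h,
          fun h => (hy y (h.lt.trans_le le_add_self)).2 h⟩⟩
  obtain ⟨g, hg, ⟨hg₁, hg₂⟩, hgS⟩ := h _ hS (fun s ⟨l, hl⟩ => hl.isSeqBelow) (by
    rintro ⟨k, hk⟩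
    obtain ⟨s, hs⟩ := exists_isStage hP k
    exact absurd (hk s ⟨k, hs⟩) (not_lt.2 hs.length_le))
  have : {n | ∃ a, P a n} = {n | M.pair n 1 ∈ g} := by
    ext n
    constructor
    · rintro ⟨a, ha⟩
      -- This restriction has a term at `max n a`, so the stage containing it has length `l > a` and
      -- has already seen the witness `a`.
      obtain ⟨s, ⟨l, hl⟩, hs⟩ := hgS (max n a + 1)
      have val : ∀ i, i < max n a + 1 → ∃ j, M.pair i j ∈ g ∧ StageMem P l (M.pair i j) := by
        intro i hi
        obtain ⟨j, hj, -⟩ := hg₂ i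
        exact ⟨j, hj, (hl.2 _).1 (hs i j hi hj)⟩
      obtain ⟨j, -, hj⟩ := val (max n a) (lt_add_one_iff_le.2 le_rfl)
      have hal : a < l := (le_max_right n a).trans_lt (stageMem_pair.1 hj).1
      obtain ⟨j, hjg, hj⟩ := val n (lt_add_one_iff_le.2 (le_max_left n a))
      rw [(stageMem_pair.1 hj).2.2.2 ⟨a, hal, ha⟩] at hjg
      exact hjg
    · intro hn
      obtain ⟨s, ⟨l, hl⟩, hs⟩ := hgS (n + 1)
      have := (hl.2 _).1 (hs n 1 (lt_add_one_iff_le.2 le_rfl) hn)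
      obtain ⟨a, -, ha⟩ := (stageMem_pair.1 this).2.2.1 rfl
      exact ⟨a, ha⟩
  rw [this]
  exact hM.out.bounded_comprehension (.mem hg (.pair (.var _) (.const _)))

/-! ### From `Σ⁰₁` comprehension to arithmetical comprehension -/

/-- The code of the first `K` values of `x`. -/
def tuple : ℕ → (ℕ → M.carrier) → M.carrier
  | 0, _ => 0
  | K + 1, x => M.pair (x 0) (tuple K fun i => x (i + 1))

omit hM in
theorem isTerm_tuple (K : ℕ) : IsTerm (tuple (M := M) K) := by
  induction K with
  | zero => exact .const 0
  | succ K ih => exact (IsTerm.var 0).pair (ih.subst fun i => .var (i + 1))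

theorem eq_of_tuple_eq {K : ℕ} {x y : ℕ → M.carrier} (h : tuple K x = tuple K y) :
    ∀ i < K, x i = y i := by
  induction K generalizing x y with
  | zero => exact fun i hi => absurd hi (Nat.not_lt_zero i)
  | succ K ih =>
    obtain ⟨h₀, h⟩ := pair_inj.1 h
    rintro (_ | i) hi
    exacts [h₀, ih h i (by omega)]

/-- Decoding the first `K` variables of `R` from a single number stays bounded, since each entry of
a tuple is at most its code. -/
theorem Definable.exists_tuple {R : (ℕ → M.carrier) → Prop} (hR : Definable false R) (K : ℕ) :
    Definable false fun x => ∃ y, x 0 = tuple K y ∧ R (mix K y fun i => x (i + 1)) := by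
  induction K generalizing R with
  | zero =>
    refine (Definable.and (.eq (.var 0) (.const 0))
      (hR.subst fun i => .var (i + 1))).of_iff fun x => ?_
    constructor
    · rintro ⟨y, h⟩
      exact h
    · intro h
      exact ⟨x, h⟩
  | succ K ih =>
    -- The head of the tuple is moved to position `K`, where the induction hypothesis treats it as
    -- one of the remaining variables.
    let R' : (ℕ → M.carrier) → Prop := fun z =>
      R (push (z K) fun i => if i < K then z i else z (i + 1))
    have hR' : Definable false R' := by
      refine hR.subst (σ := fun i z => push (z K) (fun i => if i < K then z i else z (i + 1)) i) ?_
      rintro (_ | i)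
      · exact .var K
      · change IsTerm fun z : ℕ → M.carrier => if i < K then z i else z (i + 1)
        split_ifs
        exacts [.var _, .var _]
    have key : ∀ (a : M.carrier) (y x : ℕ → M.carrier),
        R' (mix K y (push a x)) ↔ R (mix (K + 1) (push a y) x) := by
      intro a y x
      have : (push (mix K y (push a x) K) fun i => if i < K then mix K y (push a x) i
          else mix K y (push a x) (i + 1)) = mix (K + 1) (push a y) x := by
        rw [← push_mix]
        congr 1
        · simp [mix, push]
        · funext i
          by_cases hi : i < K
          · simp [mix, hi]
          · have h₁ : ¬ i + 1 < K := by omega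
            have h₂ : i + 1 - K = i - K + 1 := by omega
            simp [mix, hi, h₁, h₂, push]
      change R _ ↔ _
      rw [this]
    refine (Definable.bex (R := fun a x => ∃ d, d < x 0 + 1 ∧ (x 0 = M.pair a d ∧
      ∃ y, d = tuple K y ∧ R' (mix K y (push a fun i => x (i + 1))))) (t := fun x => x 0 + 1)
      (.add (.var _) (.const _)) (.bex (.add (.var _) (.const _))
        (.and (.eq (.var _) (.pair (.var _) (.var _))) ?_))).of_iff fun x => ?_
    · refine (ih hR').subst (σ := fun i x => push (x 0) (push (x 1) fun i => x (i + 3)) i) ?_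
      rintro (_ | _ | i)
      exacts [.var 0, .var 1, .var (i + 3)]
    · simp only [key, lt_add_one_iff_le]
      constructor
      · rintro ⟨y, hx, hy⟩
        refine ⟨y 0, ?_, tuple K fun i => y (i + 1), ?_, hx, _, rfl, ?_⟩
        · rw [hx]
          exact left_le_pair _ _
        · rw [hx]
          exact right_le_pair _ _
        · convert hy
          funext i
          cases i <;> rfl
      · rintro ⟨a, -, d, -, hx, y, rfl, hy⟩
        exact ⟨push a y, hx, hy⟩

/-- A relation depends on finitely many variables `x`, so `∀ a, P (push a x)` says that the code of
`x` avoids the set of codes of tuples having a counterexample `a`. By the induction hypothesis that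
set is Σ⁰₁, so it exists and serves as a parameter. -/
theorem Definable.toBounded
    (hsigma : ∀ {P : M.carrier → M.carrier → Prop}, Definable false (fun x => P (x 0) (x 1)) →
      {n | ∃ a, P a n} ∈ M.sets)
    {b : Bool} {P : (ℕ → M.carrier) → Prop} (h : Definable b P) : Definable false P := by
  induction h with
  | eq hs ht => exact .eq hs ht
  | lt hs ht => exact .lt hs ht
  | mem hX ht => exact .mem hX ht
  | not _ ih => exact ih.not
  | and _ _ ih₁ ih₂ => exact ih₁.and ih₂
  | ball_push ht _ ih => exact ih.ball_push ht
  | @all_push P _ ih =>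
    obtain ⟨K, hK⟩ := ih.exists_support
    -- Positions below `K` hold the coded variables and position `K` holds the possible
    -- counterexample.
    let R : (ℕ → M.carrier) → Prop := fun z => ¬ P (push (z K) z)
    have hR : Definable false R := by
      refine Definable.not (ih.subst (σ := fun i z => push (z K) z i) ?_)
      rintro (_ | i)
      exacts [.var K, .var i]
    have key : ∀ (a : M.carrier) (y : ℕ → M.carrier), R (mix K y fun _ => a) ↔ ¬ P (push a y) := by
      intro a y
      refine not_congr (hK _ _ ?_)
      rintro (_ | i) hi
      · simp [push, mix]
      · have : i < K := by omega
        simp [push, mix, this]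
    have hX := hsigma (P := fun a c => ∃ y, c = tuple K y ∧ R (mix K y fun _ => a))
      ((hR.exists_tuple K).subst (σ := fun i x => if i = 0 then x 1 else x 0) fun i => by
        split_ifs
        exacts [.var 1, .var 0])
    refine (Definable.mem hX (isTerm_tuple K)).not.of_iff fun x => ?_
    simp only [key, Set.mem_ofPred_eq]
    constructor
    · rintro h ⟨a, y, hy, hP⟩
      refine hP ((hK _ _ ?_).1 (h a))
      rintro (_ | i) hi
      exacts [rfl, eq_of_tuple_eq hy i (by omega)]
    · intro h a
      by_contra hP
      exact h ⟨a, x, rfl, hP⟩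

theorem modelsACA0_of_principle (h : M.InitialSegmentPrinciple (M.add M.one M.one)) :
    M.ModelsACA0 where
  basic := hM.out.basic
  induction X hX zero succ n :=
    hM.out.bounded_induction (P := fun n => n ∈ X) (.mem hX (.var 0)) zero succ n
  comprehension φ V v := by
    have hφ := (definable_sat V φ).toBounded (sigma_comprehension_of_principle h)
    refine ⟨_, hM.out.bounded_comprehension (P := fun n => M.Sat V φ (push n v))
      (hφ.subst (σ := fun i x => push (x 0) v i) ?_), fun n => Iff.rfl⟩
    rintro (_ | i)
    exacts [.var 0, .const _]

/-! ### The principle in models of `ACA₀` -/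

/-- Unboundedly many elements of `S` agree with `τ` below `i` and have the value `j` at `i`. -/
def Extendible (S : Set M.carrier) (τ i j : M.carrier) : Prop :=
  ∀ k, ∃ s, s ∈ S ∧ (k ≤ s ∧ ((∀ i', i' < i → ∀ j', M.CodeMem (M.pair i' j') τ →
    M.CodeMem (M.pair i' j') s) ∧ M.CodeMem (M.pair i j) s))

/-- `j` is the least value at `i` with which unboundedly many elements of `S` extend `τ`. -/
def IsLeastValue (S : Set M.carrier) (τ i j : M.carrier) : Prop :=
  Extendible S τ i j ∧ ∀ j', j' < j → ¬ Extendible S τ i j'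

/-- `τ` codes the first `n` values of the leftmost path which has unboundedly many extensions in
`S` at each level. -/
structure IsLeftmost (S : Set M.carrier) (n τ : M.carrier) : Prop where
  dom : ∀ x, M.CodeMem x τ → ∃ i j, i < n ∧ x = M.pair i j
  least : ∀ i, i < n → ∀ j, M.CodeMem (M.pair i j) τ ↔ IsLeastValue S τ i j
  total : ∀ i, i < n → ∃ j, M.CodeMem (M.pair i j) τ
  unbounded : ∀ k, ∃ s, s ∈ S ∧ (k ≤ s ∧ ∀ x, M.CodeMem x τ → M.CodeMem x s)

theorem Definable.extendible {S : Set M.carrier} (hS : S ∈ M.sets)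
    {s t u : (ℕ → M.carrier) → M.carrier} (hs : IsTerm s) (ht : IsTerm t) (hu : IsTerm u) :
    Definable true fun x => Extendible S (s x) (t x) (u x) :=
  Definable.comp₃ (R := Extendible S) (.all (.ex (.and (.mem hS (.var _))
    (.and (.le (.var _) (.var _)) (.and (.ball (.var _) (.all (.imp
      (.codeMem (.pair (.var _) (.var _)) (.var _))
      (.codeMem (.pair (.var _) (.var _)) (.var _)))))
      (.codeMem (.pair (.var _) (.var _)) (.var _))))))) hs ht hu

theorem Definable.isLeastValue {S : Set M.carrier} (hS : S ∈ M.sets)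
    {s t u : (ℕ → M.carrier) → M.carrier} (hs : IsTerm s) (ht : IsTerm t) (hu : IsTerm u) :
    Definable true fun x => IsLeastValue S (s x) (t x) (u x) :=
  Definable.comp₃ (R := IsLeastValue S) (.and (.extendible hS (.var _) (.var _) (.var _))
    (.ball (.var _) (.not (.extendible hS (.var _) (.var _) (.var _))))) hs ht hu

theorem Definable.isLeftmost {S : Set M.carrier} (hS : S ∈ M.sets)
    {s t : (ℕ → M.carrier) → M.carrier} (hs : IsTerm s) (ht : IsTerm t) :
    Definable true fun x => IsLeftmost S (s x) (t x) := by
  refine Definable.comp₂ (R := IsLeftmost S) (Definable.of_iff (P := fun x : ℕ → M.carrier =>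
    (∀ y, M.CodeMem y (x 1) → ∃ i j, i < x 0 ∧ y = M.pair i j) ∧
    ((∀ i, i < x 0 → ∀ j, M.CodeMem (M.pair i j) (x 1) ↔ IsLeastValue S (x 1) i j) ∧
    ((∀ i, i < x 0 → ∃ j, M.CodeMem (M.pair i j) (x 1)) ∧
    ∀ k, ∃ s, s ∈ S ∧ (k ≤ s ∧ ∀ y, M.CodeMem y (x 1) → M.CodeMem y s)))) ?_ fun x =>
      ⟨fun h => ⟨h.1, h.2, h.3, h.4⟩, fun h => ⟨h.1, h.2.1, h.2.2.1, h.2.2.2⟩⟩) hs ht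
  refine .and (.all (.imp (.codeMem (.var _) (.var _)) (.ex (.ex (.and (.lt (.var _) (.var _))
    (.eq (.var _) (.pair (.var _) (.var _)))))))) (.and ?_ (.and ?_ ?_))
  · exact .ball (.var _) (.all (.iff (.codeMem (.pair (.var _) (.var _)) (.var _))
      (.isLeastValue hS (.var _) (.var _) (.var _))))
  · exact .ball (.var _) (.ex (.codeMem (.pair (.var _) (.var _)) (.var _)))
  · exact .all (.ex (.and (.mem hS (.var _)) (.and (.le (.var _) (.var _))
      (.all (.imp (.codeMem (.var _) (.var _)) (.codeMem (.var _) (.var _)))))))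

/-- The choice at level `i` looks at `τ` only below `i`; hence the leftmost path is determined level
by level. -/
theorem isLeastValue_congr {S : Set M.carrier} {τ τ' i : M.carrier}
    (h : ∀ i', i' < i → ∀ j, M.CodeMem (M.pair i' j) τ ↔ M.CodeMem (M.pair i' j) τ')
    (j : M.carrier) : IsLeastValue S τ i j ↔ IsLeastValue S τ' i j := by
  have key : ∀ j, Extendible S τ i j ↔ Extendible S τ' i j := by
    intro j
    refine forall_congr' fun k => exists_congr fun s => and_congr_right fun _ =>
      and_congr_right fun _ => and_congr_left fun _ => ?_
    exact forall_congr' fun i' => forall_congr' fun hi' => forall_congr' fun j' => by rw [h i' hi']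
  simp only [IsLeastValue, key]

/-- Coherence of the approximations, by induction on the level; it makes their union single-valued.
-/
theorem IsLeftmost.codeMem_iff {S : Set M.carrier} (hA : M.ModelsACA0)
    {n n' τ τ' : M.carrier} (h : IsLeftmost S n τ) (h' : IsLeftmost S n' τ') {i : M.carrier}
    (hi : i < n) (hi' : i < n') (j : M.carrier) :
    M.CodeMem (M.pair i j) τ ↔ M.CodeMem (M.pair i j) τ' := by
  have key : ∀ m i, i < m → i < n → i < n' → ∀ j,
      M.CodeMem (M.pair i j) τ ↔ M.CodeMem (M.pair i j) τ' := by
    refine hA.arith_induction (P := fun m => ∀ i, i < m → i < n → i < n' → ∀ j,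
      M.CodeMem (M.pair i j) τ ↔ M.CodeMem (M.pair i j) τ') ?_
      (fun i hi => (not_lt_zero hi).elim) fun m ih i hi hn hn' j => ?_
    · exact .ball (.var _) (.imp (.lt (.var _) (.const _)) (.imp (.lt (.var _) (.const _))
        (.all (.iff (.codeMem (.pair (.var _) (.var _)) (.const _))
          (.codeMem (.pair (.var _) (.var _)) (.const _))))))
    · rw [h.least i hn, h'.least i hn']
      refine isLeastValue_congr (fun i' hi' => ?_) j
      exact ih i' (hi'.trans_le (lt_add_one_iff_le.1 hi)) (hi'.trans hn) (hi'.trans hn')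
  exact key (i + 1) i (lt_add_one_iff_le.2 le_rfl) hi hi' j

/-- If unboundedly many elements of `S` extend `τ`, then they have unboundedly often the same
next value: there is only one extension of `τ` without a next value. -/
theorem IsLeftmost.exists_extendible {S : Set M.carrier} (hA : M.ModelsACA0) (hS : S ∈ M.sets)
    {r : M.carrier} (hr : ∀ s ∈ S, M.IsSeqBelow r s) {n τ : M.carrier} (h : IsLeftmost S n τ) :
    ∃ j, Extendible S τ n j := by
  by_contra! hn
  -- Since `r` may be nonstandard, a common bound for all values below `r` is obtained by
  -- arithmetical induction.
  have collect : ∀ q, ∃ K, ∀ j, j < q → ∀ s, s ∈ S → K ≤ s →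
      ¬ ((∀ i', i' < n → ∀ j', M.CodeMem (M.pair i' j') τ → M.CodeMem (M.pair i' j') s) ∧
        M.CodeMem (M.pair n j) s) := by
    refine hA.arith_induction (P := fun q => ∃ K, ∀ j, j < q → ∀ s, s ∈ S → K ≤ s →
      ¬ ((∀ i', i' < n → ∀ j', M.CodeMem (M.pair i' j') τ → M.CodeMem (M.pair i' j') s) ∧
        M.CodeMem (M.pair n j) s)) ?_ ⟨0, fun j hj => (not_lt_zero hj).elim⟩ ?_
    · exact .ex (.ball (.var _) (.all (.imp (.mem hS (.var _)) (.imp (.le (.var _) (.var _))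
        (.not (.and (.ball (.const _) (.all (.imp
          (.codeMem (.pair (.var _) (.var _)) (.const _))
          (.codeMem (.pair (.var _) (.var _)) (.var _)))))
          (.codeMem (.pair (.const _) (.var _)) (.var _))))))))
    · rintro q ⟨K, hK⟩
      obtain ⟨k, hk⟩ := not_forall.1 (hn q)
      refine ⟨max K k, fun j hj s hs hle hc => ?_⟩
      rcases (lt_add_one_iff_le.1 hj).lt_or_eq with hj | rfl
      · exact hK j hj s hs ((le_max_left _ _).trans hle) hc
      · exact hk ⟨s, hs, (le_max_right _ _).trans hle, hc⟩
  obtain ⟨K, hK⟩ := collect r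
  -- Beyond `K` an extension of `τ` has no value at `n`, hence length at most `n`, where `τ` already
  -- supplies every value.
  have same : ∀ s, s ∈ S → K ≤ s → (∀ x, M.CodeMem x τ → M.CodeMem x s) →
      ∀ x, M.CodeMem x s ↔ M.CodeMem x τ := by
    intro s hs hKs hext x
    refine ⟨fun hx => ?_, hext x⟩
    obtain ⟨⟨-, hpair, hfun, l, hl⟩, hbelow⟩ := hr s hs
    obtain ⟨i, j, rfl⟩ := hpair x hx
    have hln : l ≤ n := by
      by_contra! hnl
      obtain ⟨j, hj⟩ := (hl n).1 hnl
      exact hK j (hbelow n j hj) s hs hKs ⟨fun i' _ j' => hext _, hj⟩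
    have hil : i < l := (hl i).2 ⟨j, hx⟩
    obtain ⟨j', hj'⟩ := h.total i (hil.trans_le hln)
    rwa [hfun i j j' hx (hext _ hj')]
  obtain ⟨s, hs, hKs, hext⟩ := h.unbounded K
  obtain ⟨s', hs', hlt, hext'⟩ := h.unbounded (s + 1)
  have hlt := add_one_le_iff_lt.1 hlt
  have := (hr s hs).1.1.eq (hr s' hs').1.1 fun x =>
    (same s hs hKs hext x).trans (same s' hs' (hKs.trans hlt.le) hext' x).symm
  exact hlt.ne this

theorem exists_isLeftmost {S : Set M.carrier} (hA : M.ModelsACA0) (hS : S ∈ M.sets)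
    {r : M.carrier} (hr : ∀ s ∈ S, M.IsSeqBelow r s) (hinf : M.IsInfinite S) (n : M.carrier) :
    ∃ τ, IsLeftmost S n τ := by
  refine hA.arith_induction (P := fun n => ∃ τ, IsLeftmost S n τ)
    (.ex (.isLeftmost hS (.var _) (.var _))) ?_ ?_ n
  -- The empty sequence is extended by every member of `S`, so unboundedness is the infinitude of
  -- `S`.
  · obtain ⟨τ, -, hτ⟩ := exists_isFiniteSetCode (M := M) (D := fun i => i < 0) (k := 0)
      (.lt (.var _) (.const _)) fun i hi => hi
    have hτ : ∀ x, ¬ M.CodeMem x τ := fun x hx => not_lt_zero ((hτ x).1 hx)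
    refine ⟨τ, fun x hx => (hτ x hx).elim, fun i hi => (not_lt_zero hi).elim,
      fun i hi => (not_lt_zero hi).elim, fun k => ?_⟩
    by_contra! hk
    exact hinf ⟨k, fun s hs => by
      by_contra hlt
      obtain ⟨x, hx, -⟩ := hk s hs (not_lt.1 hlt)
      exact hτ x hx⟩
  · rintro n ⟨τ, h⟩
    obtain ⟨j₀, hj₀⟩ := h.exists_extendible hA hS hr
    obtain ⟨j, hj⟩ := hA.exists_least (P := Extendible S τ n)
      (.extendible hS (.const _) (.const _) (.var _)) hj₀
    -- The next approximation adds the pair of `n` and the least extendible value `j` to `τ`.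
    obtain ⟨τ', -, hτ'⟩ := exists_isFiniteSetCode
      (D := fun x => M.CodeMem x τ ∨ x = M.pair n j) (k := τ + (M.pair n j + 1))
      (.or (.codeMem (.var _) (.const _)) (.eq (.var _) (.const _))) (by
        rintro x (hx | rfl)
        · exact hx.lt.trans_le le_self_add
        · exact (lt_add_one_iff_le.2 le_rfl).trans_le le_add_self)
    have below : ∀ i, i < n → ∀ j', M.CodeMem (M.pair i j') τ ↔ M.CodeMem (M.pair i j') τ' := by
      intro i hi j'
      rw [hτ', pair_inj, or_iff_left fun h => hi.ne h.1]
    have atn : ∀ j', M.CodeMem (M.pair n j') τ' ↔ j' = j := by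
      intro j'
      rw [hτ', pair_inj, and_iff_right rfl, or_iff_right]
      intro hx
      obtain ⟨i, j'', hi, heq⟩ := h.dom _ hx
      exact hi.ne (pair_inj.1 heq).1.symm
    refine ⟨τ', fun x hx => ?_, fun i hi j' => ?_, fun i hi => ?_, fun k => ?_⟩
    · rcases (hτ' x).1 hx with hx | rfl
      · obtain ⟨i, j', hi, rfl⟩ := h.dom x hx
        exact ⟨i, j', hi.trans (lt_add_one_iff_le.2 le_rfl), rfl⟩
      · exact ⟨n, j, lt_add_one_iff_le.2 le_rfl, rfl⟩
    · rcases (lt_add_one_iff_le.1 hi).lt_or_eq with hi | rfl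
      · rw [← below i hi, h.least i hi]
        exact isLeastValue_congr (fun i' hi' => below i' (hi'.trans hi)) j'
      · rw [atn, ← isLeastValue_congr below]
        refine ⟨fun h => h ▸ hj, fun h => ?_⟩
        exact le_antisymm (not_lt.1 fun hlt => h.2 j hlt hj.1) (not_lt.1 fun hlt => hj.2 j' hlt h.1)
    · rcases (lt_add_one_iff_le.1 hi).lt_or_eq with hi | rfl
      · obtain ⟨j', hj'⟩ := h.total i hi
        exact ⟨j', (hτ' _).2 (.inl hj')⟩
      · exact ⟨j, (atn j).2 rfl⟩
    · obtain ⟨s, hs, hk, hext, hjs⟩ := hj.1 k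
      refine ⟨s, hs, hk, fun x hx => ?_⟩
      rcases (hτ' x).1 hx with hx | rfl
      · obtain ⟨i, j', hi, rfl⟩ := h.dom x hx
        exact hext i hi j' hx
      · exact hjs

theorem principle_of_modelsACA0 (hA : M.ModelsACA0) (r : M.carrier) :
    M.InitialSegmentPrinciple r := by
  intro S hS hr hinf
  refine ⟨{x | ∃ n τ, IsLeftmost S n τ ∧ M.CodeMem x τ}, hA.comprehension_definable
    (.ex (.ex (.and (.isLeftmost hS (.var _) (.var _)) (.codeMem (.var _) (.var _))))),
    ⟨?_, fun i => ?_⟩, fun n => ?_⟩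
  · rintro x ⟨n, τ, h, hx⟩
    obtain ⟨i, j, -, rfl⟩ := h.dom x hx
    -- The bound 0 is irrelevant: any member of `S` extending `τ` shows that the values are below
    -- `r`.
    obtain ⟨s, hs, -, hext⟩ := h.unbounded 0
    exact ⟨i, j, rfl, (hr s hs).2 i j (hext _ hx)⟩
  · obtain ⟨τ, h⟩ := exists_isLeftmost hA hS hr hinf (i + 1)
    have hi : i < i + 1 := lt_add_one_iff_le.2 le_rfl
    obtain ⟨j, hj⟩ := h.total i hi
    refine ⟨j, ⟨i + 1, τ, h, hj⟩, ?_⟩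
    rintro j' ⟨n, τ', h', hj'⟩
    obtain ⟨i', j'', hi', heq⟩ := h'.dom _ hj'
    obtain ⟨rfl, -⟩ := pair_inj.1 heq
    obtain ⟨s, hs, -, hext⟩ := h.unbounded 0
    exact (hr s hs).1.2.2.1 i j' j (hext _ ((h.codeMem_iff hA h' hi hi' j').2 hj')) (hext _ hj)
  · obtain ⟨τ, h⟩ := exists_isLeftmost hA hS hr hinf n
    obtain ⟨s, hs, -, hext⟩ := h.unbounded 0
    refine ⟨s, hs, ?_⟩
    rintro i j hi ⟨n', τ', h', hj⟩
    obtain ⟨i', j', hi', heq⟩ := h'.dom _ hj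
    obtain ⟨rfl, -⟩ := pair_inj.1 heq
    exact hext _ ((h.codeMem_iff hA h' hi hi' j).2 hj)

end L2Structure

theorem mainTheorem8 (M : L2Structure.{u}) (hM : M.ModelsRCA0) :
    List.TFAE [
      M.ModelsACA0,
      ∀ r : M.carrier, M.InitialSegmentPrinciple r,
      M.InitialSegmentPrinciple (M.add M.one M.one)] := by
  have : Fact M.ModelsRCA0 := ⟨hM⟩
  tfae_have 1 → 2 := L2Structure.principle_of_modelsACA0
  tfae_have 2 → 3 := fun h => h _
  tfae_have 3 → 1 := L2Structure.modelsACA0_of_principle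
  tfae_finish
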